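/- Let $\mathbb{N}=\{1,2,\dots\}$, and for $p\in[1,\infty]$ let $\|\cdot\|_p$ denote the $p$-norm on $\ell^p(\mathbb{N})$, $\ell^p(\mathbb{Z})$ or $\mathbb{C}^n$, and also the induced operator norm. For a bounded linear operator (or square matrix) $B$ on one of these spaces and $\varepsilon>0$ let $$\operatorname{spec}_\varepsilon^p B := \operatorname{spec} B\cup\{\lambda\in\mathbb{C} : \|(B-\lambda I)^{-1}\|_p>\varepsilon^{-1}\}.$$ For $b\in\{\pm1\}^{\mathbb{Z}}$ let $A^b$ be the operator on $\ell^p(\mathbb{Z})$ given by the matrix with entries $a_{ij}=b_{i-1}\delta_{i-1,j}+\delta_{i+1,j}$, $i,j\in\mathbb{Z}$; for $b\in\{\pm1\}^{\mathbb{N}}$ let $A_+^b$ be the operator on $\ell^p(\mathbb{N})$ given by the matrix with entries $b_{i-1}\delta_{i-1,j}+\delta_{i+1,j}$, $i,j\in\mathbb{N}$ (the first term being absent for $i=1$). Let $A_{\ell,m}^b$ be the finite section of this matrix with $i,j\in\{\ell,\dots,m\}$, and let $A_n^b$ be the $n\times n$ tridiagonal matrix with zero diagonal, ones on the first superdiagonal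 and $b_1,\dots,b_{n-1}$ on the first subdiagonal. Let $$\Sigma_\varepsilon^p := \bigcup_{c\in\{\pm1\}^{\mathbb{Z}}}\operatorname{spec}_\varepsilon^p A^c .$$ A sequence $b\in\{\pm1\}^{\mathbb{N}}$ or $b\in\{\pm1\}^{\mathbb{Z}}$ is pseudo-ergodic if every finite sequence of $\pm1$'s occurs in $b$ as a block of consecutive terms. Write $T_n\nearrow T$ if $T_n\subseteq T$ for every $n$ and the Hausdorff distance $\max\bigl(\sup_{z\in T}\operatorname{dist}(z,T_n),\sup_{z\in T_n}\operatorname{dist}(z,T)\bigr)$ tends to $0$. (a) If $b\in\{\pm1\}^{\mathbb{N}}$ is pseudo-ergodic then, for every $\varepsilon>0$ and $p\in[1,\infty]$, $$\operatorname{spec}_\varepsilon^p A_n^b=\operatorname{spec}_\varepsilon^p A_{1,n}^b\nearrow\operatorname{spec}_\varepsilon^p A_+^b=\Sigma_\varepsilon^p\qquad\text{as } n\to\infty .$$ (b) If $b\in\{\pm1\}^{\mathbb{Z}}$ is pseudo-ergodic then, for every $\varepsilon>0$ and $p\in[1,\infty]$, $$\operatorname{spec}_\varepsilon^p A_{\ell,m}^b\nearrow\operatorname{spec}_\varepsilon^p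 A^b=\Sigma_\varepsilon^p\qquad\text{as } \ell\to-\infty \text{ and } m\to\infty ,$$ that is, the inclusion holds for all integers $\ell\le m$, and the Hausdorff distance tends to $0$ as $\ell\to-\infty$ and $m\to\infty$ independently. -/

import Mathlib

open scoped ENNReal Topology

noncomputable section

namespace HoppingSign

/-- The tridiagonal matrix with zero diagonal, ones on the first superdiagonal and `b` on the first
subdiagonal: the entry in row `i` and column `j` is `b (i - 1) δ (i - 1) j + δ (i + 1) j`. The index
type is `ℤ` (bi-infinite case) or `ℕ+` (semi-infinite case); a sequence of signs is a function with
values in `ℤˣ = {1, -1}`. -/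
def hopMatrix {S : Type} [Add S] [One S] [DecidableEq S] (b : S → ℤˣ) : Matrix S S ℂ :=
  Matrix.of fun i j =>
    (if i = j + 1 then (((b j : ℤˣ) : ℤ) : ℂ) else 0) + (if j = i + 1 then 1 else 0)

/-- The order `n` matrix with zero diagonal, ones on the first superdiagonal and `b₁, …, bₙ₋₁` on
the first subdiagonal. Rows and columns are numbered from `0` here, so that the entry in row
`j + 1` and column `j` is `b` at the positive integer `j + 1`. -/
def finMatrix (b : ℕ+ → ℤˣ) (n : ℕ) : Matrix (Fin n) (Fin n) ℂ :=
  Matrix.of fun i j =>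
    if (i : ℕ) = j + 1 then (((b (Nat.succPNat j) : ℤˣ) : ℤ) : ℂ)
    else if (j : ℕ) = i + 1 then 1 else 0

/-- The finite section of `hopMatrix b` with rows and columns in `{l, …, m}`. -/
def sectionMatrix {S : Type} [Add S] [One S] [DecidableEq S] [Preorder S] [LocallyFiniteOrder S]
    (b : S → ℤˣ) (l m : S) : Matrix (Finset.Icc l m) (Finset.Icc l m) ℂ :=
  (hopMatrix b).submatrix (fun i => (i : S)) (fun j => (j : S))

theorem succ_injective {S : Type} [Add S] [One S] [IsRightCancelAdd S] :
    Function.Injective (fun k : S => k + 1) :=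
  fun _ _ h => add_right_cancel h

/-- The action of `hopMatrix b` is `(A x) i = x (i + 1) + b (i - 1) x (i - 1)`, the second term being
absent if `i` has no predecessor. -/
theorem hop_hasSum {S : Type} [Add S] [One S] [DecidableEq S] [IsRightCancelAdd S]
    (b : S → ℤˣ) (x : S → ℂ) (i : S) :
    HasSum (fun j => hopMatrix b i j * x j)
      (x (i + 1) +
        Function.extend (fun k : S => k + 1) (fun k => (((b k : ℤˣ) : ℤ) : ℂ) * x k) 0 i) := by
  have h1 : HasSum (fun j => (if j = i + 1 then (1 : ℂ) else 0) * x j) (x (i + 1)) := by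
    have := hasSum_ite_eq (i + 1) (x (i + 1))
    convert this using 2 with j
    split_ifs with h
    · rw [h, one_mul]
    · rw [zero_mul]
  have h2 : HasSum (fun j => (if i = j + 1 then (((b j : ℤˣ) : ℤ) : ℂ) else 0) * x j)
      (Function.extend (fun k : S => k + 1) (fun k => (((b k : ℤˣ) : ℤ) : ℂ) * x k) 0 i) := by
    by_cases hi : ∃ k : S, k + 1 = i
    · obtain ⟨k, rfl⟩ := hi
      rw [succ_injective.extend_apply (fun k => (((b k : ℤˣ) : ℤ) : ℂ) * x k) 0 k]
      have := hasSum_ite_eq k ((((b k : ℤˣ) : ℤ) : ℂ) * x k)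
      convert this using 2 with j
      by_cases h : j = k
      · simp [h]
      · have h' : ¬ k + 1 = j + 1 := fun e => h (add_right_cancel e).symm
        simp [h, h']
    · rw [Function.extend_apply' _ _ _ hi]
      rw [Pi.zero_apply]
      convert (hasSum_zero : HasSum (fun _ : S => (0 : ℂ)) 0) using 2 with j
      rw [if_neg (fun e => hi ⟨j, e.symm⟩), zero_mul]
  convert h1.add h2 using 2 with j
  simp only [hopMatrix, Matrix.of_apply]
  ring

theorem memℓp_comp {S : Type} {p : ℝ≥0∞} [Fact (1 ≤ p)] {g : S → S} (hg : Function.Injective g)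
    (x : lp (fun _ : S => ℂ) p) : Memℓp (fun i => x (g i)) p := by
  rcases eq_or_ne p ∞ with rfl | hp
  · refine memℓp_infty ?_
    obtain ⟨C, hC⟩ := (lp.memℓp x).bddAbove
    refine ⟨C, ?_⟩
    rintro _ ⟨i, rfl⟩
    exact hC ⟨g i, rfl⟩
  · have hp' : 0 < p.toReal :=
      ENNReal.toReal_pos (zero_lt_one.trans_le (Fact.out : 1 ≤ p)).ne' hp
    exact memℓp_gen (((lp.memℓp x).summable hp').comp_injective hg)

theorem norm_comp_le {S : Type} {p : ℝ≥0∞} [Fact (1 ≤ p)] {g : S → S} (hg : Function.Injective g)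
    (x : lp (fun _ : S => ℂ) p) :
    ‖(⟨fun i => x (g i), memℓp_comp hg x⟩ : lp (fun _ : S => ℂ) p)‖ ≤ ‖x‖ := by
  rcases eq_or_ne p ∞ with rfl | hp
  · exact lp.norm_le_of_forall_le (norm_nonneg x)
      fun i => lp.norm_apply_le_norm ENNReal.top_ne_zero x (g i)
  · have hp' : 0 < p.toReal :=
      ENNReal.toReal_pos (zero_lt_one.trans_le (Fact.out : 1 ≤ p)).ne' hp
    refine lp.norm_le_of_tsum_le hp' (norm_nonneg x) ?_
    rw [lp.norm_rpow_eq_tsum hp' x]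
    exact tsum_comp_le_tsum_of_inj ((lp.memℓp x).summable hp') (fun _ => by positivity) hg

theorem norm_extend_rpow {S : Type} {g : S → S} (hg : Function.Injective g) (b : S → ℤˣ)
    (x : S → ℂ) {r : ℝ} (hr : 0 < r) :
    (fun i => ‖Function.extend g (fun k => (((b k : ℤˣ) : ℤ) : ℂ) * x k) 0 i‖ ^ r) =
      Function.extend g (fun k => ‖x k‖ ^ r) 0 := by
  funext i
  by_cases hi : ∃ k, g k = i
  · obtain ⟨k, rfl⟩ := hi
    rw [hg.extend_apply, hg.extend_apply]
    rcases Int.units_eq_one_or (b k) with h | h <;> simp [h]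
  · rw [Function.extend_apply' _ _ _ hi, Function.extend_apply' _ _ _ hi]
    simp [hr.ne']

theorem norm_extend_le {S : Type} {p : ℝ≥0∞} [Fact (1 ≤ p)] {g : S → S}
    (hg : Function.Injective g) (b : S → ℤˣ) (x : lp (fun _ : S => ℂ) p) (i : S) :
    ‖Function.extend g (fun k => (((b k : ℤˣ) : ℤ) : ℂ) * x k) 0 i‖ ≤ ‖x‖ := by
  by_cases hi : ∃ k, g k = i
  · obtain ⟨k, rfl⟩ := hi
    rw [hg.extend_apply]
    have := lp.norm_apply_le_norm (zero_lt_one.trans_le (Fact.out : 1 ≤ p)).ne' x k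
    rcases Int.units_eq_one_or (b k) with h | h <;> simpa [h] using this
  · rw [Function.extend_apply' _ _ _ hi]
    simp

theorem memℓp_extend {S : Type} {p : ℝ≥0∞} [Fact (1 ≤ p)] {g : S → S} (hg : Function.Injective g)
    (b : S → ℤˣ) (x : lp (fun _ : S => ℂ) p) :
    Memℓp (fun i => Function.extend g (fun k => (((b k : ℤˣ) : ℤ) : ℂ) * x k) 0 i) p := by
  rcases eq_or_ne p ∞ with rfl | hp
  · refine memℓp_infty ⟨‖x‖, ?_⟩
    rintro _ ⟨i, rfl⟩
    exact norm_extend_le hg b x i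
  · have hp' : 0 < p.toReal :=
      ENNReal.toReal_pos (zero_lt_one.trans_le (Fact.out : 1 ≤ p)).ne' hp
    refine memℓp_gen ?_
    rw [norm_extend_rpow hg b x hp']
    exact (hasSum_extend_zero hg).2 ((lp.memℓp x).summable hp').hasSum |>.summable

theorem norm_extend_lp_le {S : Type} {p : ℝ≥0∞} [Fact (1 ≤ p)] {g : S → S}
    (hg : Function.Injective g) (b : S → ℤˣ) (x : lp (fun _ : S => ℂ) p) :
    ‖(⟨fun i => Function.extend g (fun k => (((b k : ℤˣ) : ℤ) : ℂ) * x k) 0 i,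
      memℓp_extend hg b x⟩ : lp (fun _ : S => ℂ) p)‖ ≤ ‖x‖ := by
  rcases eq_or_ne p ∞ with rfl | hp
  · exact lp.norm_le_of_forall_le (norm_nonneg x) fun i => norm_extend_le hg b x i
  · have hp' : 0 < p.toReal :=
      ENNReal.toReal_pos (zero_lt_one.trans_le (Fact.out : 1 ≤ p)).ne' hp
    refine lp.norm_le_of_tsum_le hp' (norm_nonneg x) ?_
    rw [lp.norm_rpow_eq_tsum hp' x]
    have h := norm_extend_rpow hg b x hp'
    refine le_of_eq ?_
    change ∑' i, ‖Function.extend g (fun k => (((b k : ℤˣ) : ℤ) : ℂ) * x k) 0 i‖ ^ p.toReal = _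
    rw [h]
    exact tsum_extend_zero hg _

theorem hop_eq {S : Type} [Add S] [One S] [DecidableEq S] [IsRightCancelAdd S]
    (b : S → ℤˣ) (x : S → ℂ) :
    (fun i => ∑' j, hopMatrix b i j * x j) = (fun i => x (i + 1)) + fun i =>
      Function.extend (fun k : S => k + 1) (fun k => (((b k : ℤˣ) : ℤ) : ℂ) * x k) 0 i :=
  funext fun i => (hop_hasSum b x i).tsum_eq

theorem memℓp_hop {S : Type} [Add S] [One S] [DecidableEq S] [IsRightCancelAdd S]
    {p : ℝ≥0∞} [Fact (1 ≤ p)] (b : S → ℤˣ) (x : lp (fun _ : S => ℂ) p) :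
    Memℓp (fun i => ∑' j, hopMatrix b i j * x j) p := by
  rw [hop_eq]
  exact (memℓp_comp succ_injective x).add (memℓp_extend succ_injective b x)

theorem norm_hop_le {S : Type} [Add S] [One S] [DecidableEq S] [IsRightCancelAdd S]
    {p : ℝ≥0∞} [Fact (1 ≤ p)] (b : S → ℤˣ) (x : lp (fun _ : S => ℂ) p) :
    ‖(⟨fun i => ∑' j, hopMatrix b i j * x j, memℓp_hop b x⟩ : lp (fun _ : S => ℂ) p)‖
      ≤ 2 * ‖x‖ := by
  have h : (⟨fun i => ∑' j, hopMatrix b i j * x j, memℓp_hop b x⟩ : lp (fun _ : S => ℂ) p) =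
      ⟨fun i => x (i + 1), memℓp_comp succ_injective x⟩ + ⟨_, memℓp_extend succ_injective b x⟩ :=
    lp.ext (hop_eq b x)
  rw [h, two_mul]
  exact (norm_add_le _ _).trans
    (add_le_add (norm_comp_le succ_injective x) (norm_extend_lp_le succ_injective b x))

/-- The bounded operator on `ℓᵖ(S)` that acts by multiplication by the infinite matrix
`hopMatrix b`, for `S = ℤ` or `S = ℕ+`. -/
def hopOp (p : ℝ≥0∞) [Fact (1 ≤ p)] {S : Type} [Add S] [One S] [DecidableEq S]
    [IsRightCancelAdd S] (b : S → ℤˣ) : lp (fun _ : S => ℂ) p →L[ℂ] lp (fun _ : S => ℂ) p :=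
  LinearMap.mkContinuous
    { toFun := fun x => ⟨fun i => ∑' j, hopMatrix b i j * x j, memℓp_hop b x⟩
      map_add' := fun x y => lp.ext <| funext fun i => by
        change ∑' j, hopMatrix b i j * (x j + y j) =
          ∑' j, hopMatrix b i j * x j + ∑' j, hopMatrix b i j * y j
        rw [← (hop_hasSum b x i).summable.tsum_add (hop_hasSum b y i).summable]
        simp only [mul_add]
      map_smul' := fun c x => lp.ext <| funext fun i => by
        change ∑' j, hopMatrix b i j * (c * x j) = c * ∑' j, hopMatrix b i j * x j
        rw [← tsum_mul_left]
        simp only [mul_left_comm] }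
    2 fun x => norm_hop_le b x

/-- The operator of multiplication by a finite square matrix on `ℂⁿ` with the `p`-norm. -/
def matOp (p : ℝ≥0∞) [Fact (1 ≤ p)] {ι : Type} [Fintype ι] [DecidableEq ι] (M : Matrix ι ι ℂ) :
    PiLp p (fun _ : ι => ℂ) →L[ℂ] PiLp p (fun _ : ι => ℂ) :=
  LinearMap.toContinuousLinearMap (Matrix.toLpLin p p M)

/-- The `ε`-pseudospectrum of a bounded operator: the spectrum together with the points where the
norm of the resolvent exceeds `ε⁻¹`. -/
def pseudospectrum {E : Type} [NormedAddCommGroup E] [NormedSpace ℂ E] (ε : ℝ) (B : E →L[ℂ] E) :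
    Set ℂ :=
  spectrum ℂ B ∪ {z : ℂ | ε⁻¹ < ‖Ring.inverse (B - z • (1 : E →L[ℂ] E))‖}

/-- The union of the `ℓᵖ` `ε`-pseudospectra of the bi-infinite operators over all sign sequences. -/
def SigmaEps (p : ℝ≥0∞) [Fact (1 ≤ p)] (ε : ℝ) : Set ℂ :=
  ⋃ c : ℤ → ℤˣ, pseudospectrum ε (hopOp p c)

/-- Every finite pattern of signs occurs in the bi-infinite sequence `b`. -/
def PseudoErgodicInt (b : ℤ → ℤˣ) : Prop :=
  ∀ (N : ℕ) (w : Fin N → ℤˣ), ∃ J : ℤ, ∀ n : Fin N, b (((n : ℕ) : ℤ) + 1 + J) = w n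

/-- Every finite pattern of signs occurs in the sequence `b = (b₁, b₂, …)`. -/
def PseudoErgodicNat (b : ℕ+ → ℤˣ) : Prop :=
  ∀ (N : ℕ) (w : Fin N → ℤˣ), ∃ J : ℕ, ∀ n : Fin N, b (Nat.succPNat ((n : ℕ) + J)) = w n

end HoppingSign

end

/-! Everything is phrased through approximate eigenvectors. In finite dimension, `z` lies in the
pseudospectrum of a section exactly when some `f` supported in the section satisfies `‖P (A - z) f‖
< ε ‖f‖`, with `P` the truncation to the section.

From a section to the infinite operator (`exists_reflected`, `exists_copies`): such an `f` is
reflected about an added zero entry. The reflection transposes the matrix, a diagonal change of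
signs undoes this, and one free sign makes the residual vanish at the centre. The two end values now
have equal modulus, so copies separated by single zeros can be joined with unimodular factors. With
slowly varying weights on the copies, the residual at the joints is negligible, and the result is a
finitely supported approximate eigenvector, without truncation, for some other sign sequence. A
pseudo-ergodic `b` contains these signs, so the vector can be moved into `A^b` and into every
section of it that is large enough.

From the infinite operator to a section (`exists_solution`, `eq_zero_of_hopResid_eq_zero`): if `z`
lies in no section pseudospectrum, the section equations are solvable with the uniform bound `ε⁻¹`.
Compactness and Fatou yield a solution of the infinite system with the same bound, and exponential
weights show that bounded solutions of the homogeneous system vanish. Hence `A - z` is invertible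
with `‖(A - z)⁻¹‖ ≤ ε⁻¹`.

Together these identify all the infinite pseudospectra and put each of their points into all large
sections; boundedness turns this pointwise statement into Hausdorff convergence. -/

noncomputable section

namespace HoppingSign

/-! ### The `p`-norm of arbitrary families, for all `p` at once -/

section LpENorm

/-- The `p`-norm of a family of complex numbers, with values in `[0, ∞]`. -/
def lpENorm (p : ℝ≥0∞) {ι : Type} (f : ι → ℂ) : ℝ≥0∞ :=
  @MeasureTheory.eLpNorm ι ℂ _ ⊤ f p (@MeasureTheory.Measure.count ι ⊤)

variable {p : ℝ≥0∞} {ι κ : Type}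

theorem lpENorm_top (f : ι → ℂ) : lpENorm ∞ f = ⨆ i, ‖f i‖ₑ := by
  let : MeasurableSpace ι := ⊤
  rw [lpENorm, MeasureTheory.eLpNorm_exponent_top]
  exact MeasureTheory.eLpNormEssSup_count f

theorem lpENorm_of_ne_top (hp0 : p ≠ 0) (hp : p ≠ ∞) (f : ι → ℂ) :
    lpENorm p f = (∑' i, ‖f i‖ₑ ^ p.toReal) ^ (1 / p.toReal) := by
  let : MeasurableSpace ι := ⊤
  rw [lpENorm, MeasureTheory.eLpNorm_eq_lintegral_rpow_enorm_toReal hp0 hp,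
    MeasureTheory.lintegral_count]

theorem lpENorm_mono {f g : ι → ℂ} (h : ∀ i, ‖f i‖ ≤ ‖g i‖) : lpENorm p f ≤ lpENorm p g :=
  let : MeasurableSpace ι := ⊤
  MeasureTheory.eLpNorm_mono h

theorem lpENorm_congr_norm {f g : ι → ℂ} (h : ∀ i, ‖f i‖ = ‖g i‖) :
    lpENorm p f = lpENorm p g :=
  le_antisymm (lpENorm_mono fun i => (h i).le) (lpENorm_mono fun i => (h i).ge)

theorem lpENorm_add_le (hp : 1 ≤ p) (f g : ι → ℂ) :
    lpENorm p (f + g) ≤ lpENorm p f + lpENorm p g :=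
  let : MeasurableSpace ι := ⊤
  MeasureTheory.eLpNorm_add_le (measurable_from_top (f := f)).aestronglyMeasurable
    (measurable_from_top (f := g)).aestronglyMeasurable hp

theorem lpENorm_const_smul (a : ℂ) (f : ι → ℂ) : lpENorm p (a • f) = ‖a‖ₑ * lpENorm p f :=
  let : MeasurableSpace ι := ⊤
  MeasureTheory.eLpNorm_const_smul a f p _

theorem enorm_le_lpENorm (hp : p ≠ 0) (f : ι → ℂ) (i : ι) : ‖f i‖ₑ ≤ lpENorm p f :=
  let : MeasurableSpace ι := ⊤
  MeasureTheory.enorm_le_eLpNorm_count f i hp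

theorem lpENorm_ne_top_of_finite [Finite ι] (f : ι → ℂ) : lpENorm p f ≠ ∞ :=
  let : MeasurableSpace ι := ⊤
  (MeasureTheory.eLpNorm_count_lt_top_of_lt fun _ => enorm_lt_top).ne

theorem lpENorm_zero : lpENorm p (0 : ι → ℂ) = 0 :=
  let : MeasurableSpace ι := ⊤
  MeasureTheory.eLpNorm_zero

theorem lpENorm_eq_zero (hp : p ≠ 0) {f : ι → ℂ} : lpENorm p f = 0 ↔ f = 0 := by
  refine ⟨fun h => funext fun i => ?_, fun h => h ▸ lpENorm_zero⟩
  have := enorm_le_lpENorm hp f i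
  rw [h] at this
  simpa using this

/-- Zero entries do not contribute. This lets sections, `ℕ+` and products all be treated as families
on `ℤ`. -/
theorem lpENorm_comp (hp0 : p ≠ 0) {φ : κ → ι} (hφ : φ.Injective) {f : ι → ℂ}
    (hf : ∀ i, i ∉ Set.range φ → f i = 0) : lpENorm p (fun k => f (φ k)) = lpENorm p f := by
  rcases eq_or_ne p ∞ with rfl | hp
  · rw [lpENorm_top, lpENorm_top]
    refine le_antisymm (iSup_le fun k => le_iSup (fun i => ‖f i‖ₑ) (φ k)) (iSup_le fun i => ?_)
    by_cases hi : i ∈ Set.range φ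
    · obtain ⟨k, rfl⟩ := hi
      exact le_iSup (fun k => ‖f (φ k)‖ₑ) k
    · simp [hf i hi]
  · rw [lpENorm_of_ne_top hp0 hp, lpENorm_of_ne_top hp0 hp]
    congr 1
    refine hφ.tsum_eq (f := fun i => ‖f i‖ₑ ^ p.toReal) fun i hi => ?_
    by_contra h
    exact hi (by simp [hf i h, ENNReal.toReal_pos hp0 hp])

/-- Multiplicativity on elementary tensors gives the exact norms of weighted copies of one block,
for every `p` including `∞`. -/
theorem lpENorm_mul_prod (hp0 : p ≠ 0) (w : κ → ℂ) (f : ι → ℂ) :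
    lpENorm p (fun q : κ × ι => w q.1 * f q.2) = lpENorm p w * lpENorm p f := by
  rcases eq_or_ne p ∞ with rfl | hp
  · simp only [lpENorm_top, iSup_prod, enorm_mul, ENNReal.iSup_mul, ENNReal.mul_iSup]
    exact iSup_comm
  · have h : 0 < p.toReal := ENNReal.toReal_pos hp0 hp
    simp only [lpENorm_of_ne_top hp0 hp, ENNReal.tsum_prod', enorm_mul,
      ENNReal.mul_rpow_of_nonneg _ _ h.le, ENNReal.tsum_mul_left, ENNReal.tsum_mul_right]
    rw [ENNReal.mul_rpow_of_nonneg _ _ (by positivity)]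

theorem lpENorm_single (hp0 : p ≠ 0) [DecidableEq ι] (i : ι) (a : ℂ) :
    lpENorm p (Pi.single i a) = ‖a‖ₑ := by
  rcases eq_or_ne p ∞ with rfl | hp
  · rw [lpENorm_top]
    refine le_antisymm (iSup_le fun j => ?_) ?_
    · rcases eq_or_ne j i with rfl | h
      · simp
      · simp [h]
    · simpa using le_iSup (fun j => ‖(Pi.single i a : ι → ℂ) j‖ₑ) i
  · have h : 0 < p.toReal := ENNReal.toReal_pos hp0 hp
    rw [lpENorm_of_ne_top hp0 hp, tsum_eq_single i]
    · simp [← ENNReal.rpow_mul, h.ne']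
    · intro j hj
      simp [hj, h]

theorem memℓp_of_lpENorm_ne_top (hp0 : p ≠ 0) {f : ι → ℂ} (hf : lpENorm p f ≠ ∞) :
    Memℓp f p := by
  rcases eq_or_ne p ∞ with rfl | hp
  · refine memℓp_infty ⟨(lpENorm ∞ f).toReal, ?_⟩
    rintro _ ⟨i, rfl⟩
    have := ENNReal.toReal_mono hf (enorm_le_lpENorm hp0 f i)
    simpa using this
  · have h : 0 < p.toReal := ENNReal.toReal_pos hp0 hp
    refine memℓp_gen ?_
    rw [lpENorm_of_ne_top hp0 hp] at hf
    have h2 : ∑' i, ‖f i‖ₑ ^ p.toReal ≠ ∞ := by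
      intro h3
      rw [h3] at hf
      exact hf (ENNReal.top_rpow_of_pos (by positivity))
    have := ENNReal.summable_toReal h2
    simpa [← ENNReal.toReal_rpow] using this

theorem enorm_lp_eq [Fact (1 ≤ p)] (x : lp (fun _ : ι => ℂ) p) : ‖x‖ₑ = lpENorm p x := by
  have hp0 : p ≠ 0 := (zero_lt_one.trans_le (Fact.out : 1 ≤ p)).ne'
  rcases eq_or_ne p ∞ with rfl | hp
  · rw [lpENorm_top]
    refine le_antisymm ?_ (iSup_le fun i => ?_)
    · by_cases hT : ⨆ i, ‖x i‖ₑ = ∞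
      · simp [hT]
      · rw [← ofReal_norm, ENNReal.ofReal_le_iff_le_toReal hT]
        refine lp.norm_le_of_forall_le ENNReal.toReal_nonneg fun i => ?_
        have := ENNReal.toReal_mono hT (le_iSup (fun i => ‖x i‖ₑ) i)
        simpa using this
    · rw [← ofReal_norm, ← ofReal_norm]
      exact ENNReal.ofReal_le_ofReal (lp.norm_apply_le_norm hp0 x i)
  · have h : 0 < p.toReal := ENNReal.toReal_pos hp0 hp
    have hs := (lp.memℓp x).summable h
    rw [lpENorm_of_ne_top hp0 hp, ← ofReal_norm, lp.norm_eq_tsum_rpow h,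
      ← ENNReal.ofReal_rpow_of_nonneg (tsum_nonneg fun _ => by positivity) (by positivity),
      ENNReal.ofReal_tsum_of_nonneg (fun _ => by positivity) hs]
    congr 2 with i
    rw [← ENNReal.ofReal_rpow_of_nonneg (norm_nonneg _) h.le, ofReal_norm]

theorem enorm_piLp_eq [Fact (1 ≤ p)] [Fintype ι] (x : PiLp p (fun _ : ι => ℂ)) :
    ‖x‖ₑ = lpENorm p (fun i => x i) := by
  have h := enorm_lp_eq ((lpPiLpₗᵢ (fun _ : ι => ℂ) ℂ).symm x)
  rw [coe_lpPiLpₗᵢ_symm] at h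
  rw [← h, ← ofReal_norm, ← ofReal_norm, LinearIsometryEquiv.norm_map]

/-- Fatou's lemma for the counting measure. -/
theorem lpENorm_le_of_tendsto {F : ℕ → ι → ℂ} [Countable ι] {f : ι → ℂ}
    (h : ∀ i, Filter.Tendsto (fun n => F n i) Filter.atTop (𝓝 (f i))) {C : ℝ≥0∞}
    (hC : ∀ n, lpENorm p (F n) ≤ C) : lpENorm p f ≤ C := by
  let : MeasurableSpace ι := ⊤
  refine (MeasureTheory.Lp.eLpNorm_lim_le_liminf_eLpNorm
    (fun n => (measurable_from_top (f := F n)).aestronglyMeasurable) f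
    (Filter.Eventually.of_forall h)).trans ?_
  exact Filter.liminf_le_of_frequently_le' (Filter.Frequently.of_forall hC)

theorem lpENorm_ne_top_of_support_subset (hp0 : p ≠ 0) {f : ι → ℂ} {s : Set ι} (hs : s.Finite)
    (hf : ∀ i, i ∉ s → f i = 0) : lpENorm p f ≠ ∞ := by
  have := hs.to_subtype
  rw [← lpENorm_comp hp0 (φ := ((↑) : s → ι)) Subtype.val_injective
    (fun i hi => hf i (by simpa using hi))]
  exact lpENorm_ne_top_of_finite _

end LpENorm

/-! ### Pseudospectra and approximate eigenvectors -/

section Pseudospectrum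

variable {E : Type} [NormedAddCommGroup E] [NormedSpace ℂ E] {ε : ℝ} {B : E →L[ℂ] E} {z : ℂ}

theorem notMem_spectrum_iff : z ∉ spectrum ℂ B ↔ IsUnit (B - z • (1 : E →L[ℂ] E)) := by
  rw [spectrum.notMem_iff, Algebra.algebraMap_eq_smul_one, ← neg_sub, IsUnit.neg_iff]

theorem mem_pseudospectrum_of_lt (hε : 0 < ε) {x : E} (hx : ‖B x - z • x‖ < ε * ‖x‖) :
    z ∈ pseudospectrum ε B := by
  by_cases hz : z ∈ spectrum ℂ B
  · exact Or.inl hz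
  · refine Or.inr ?_
    rw [notMem_spectrum_iff] at hz
    have h1 := Ring.inverse_mul_cancel _ hz
    have h2 : Ring.inverse (B - z • (1 : E →L[ℂ] E)) (B x - z • x) = x := congr($h1 x)
    have h3 := (Ring.inverse (B - z • (1 : E →L[ℂ] E))).le_opNorm (B x - z • x)
    rw [h2] at h3
    have hx0 : 0 < ‖x‖ := by
      by_contra h
      have : ‖x‖ = 0 := le_antisymm (not_lt.1 h) (norm_nonneg x)
      rw [this, mul_zero] at hx
      exact absurd hx (not_lt.2 (norm_nonneg _))
    change ε⁻¹ < _
    by_contra h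
    have h4 := mul_le_mul_of_nonneg_right (not_lt.1 h) (norm_nonneg (B x - z • x))
    have h5 : ε⁻¹ * ‖B x - z • x‖ < ‖x‖ := by
      rw [inv_mul_lt_iff₀ hε]
      exact hx
    linarith

/-- The lower bound gives injectivity and the resolvent estimate, but a point of the spectrum may
still satisfy it; surjectivity has to be supplied separately. -/
theorem notMem_pseudospectrum [CompleteSpace E] (hε : 0 < ε)
    (hsurj : ∀ y : E, ∃ x, B x - z • x = y) (h : ∀ x, ε * ‖x‖ ≤ ‖B x - z • x‖) :
    z ∉ pseudospectrum ε B := by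
  have hu : IsUnit (B - z • (1 : E →L[ℂ] E)) := by
    rw [ContinuousLinearMap.isUnit_iff_bijective]
    refine ⟨(injective_iff_map_eq_zero _).2 fun x hx => ?_, hsurj⟩
    have h1 := h x
    rw [show B x - z • x = 0 from hx, norm_zero] at h1
    exact norm_eq_zero.1 (le_antisymm (nonpos_of_mul_nonpos_right h1 hε) (norm_nonneg x))
  rintro (h1 | h1)
  · exact notMem_spectrum_iff.2 hu h1
  · refine not_lt.2 ?_ (show ε⁻¹ < _ from h1)
    refine ContinuousLinearMap.opNorm_le_bound _ (by positivity) fun y => ?_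
    have h2 := h (Ring.inverse (B - z • (1 : E →L[ℂ] E)) y)
    have h3 : (B - z • (1 : E →L[ℂ] E)) (Ring.inverse (B - z • (1 : E →L[ℂ] E)) y) = y :=
      congr($(Ring.mul_inverse_cancel _ hu) y)
    rw [show B (Ring.inverse (B - z • (1 : E →L[ℂ] E)) y) -
      z • (Ring.inverse (B - z • (1 : E →L[ℂ] E)) y) = y from h3] at h2
    rwa [le_inv_mul_iff₀ hε]

theorem mem_pseudospectrum_iff_of_finiteDimensional [FiniteDimensional ℂ E] (hε : 0 < ε) :
    z ∈ pseudospectrum ε B ↔ ∃ x, ‖B x - z • x‖ < ε * ‖x‖ := by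
  refine ⟨fun hz => ?_, fun ⟨x, hx⟩ => mem_pseudospectrum_of_lt hε hx⟩
  by_contra! h
  have := FiniteDimensional.complete ℂ E
  refine notMem_pseudospectrum hε ?_ h hz
  have hinj : Function.Injective ((B - z • (1 : E →L[ℂ] E) : E →L[ℂ] E) : E →ₗ[ℂ] E) :=
    (injective_iff_map_eq_zero _).2 fun x hx => by
      have h1 := h x
      rw [show B x - z • x = 0 from hx, norm_zero] at h1
      exact norm_eq_zero.1 (le_antisymm (nonpos_of_mul_nonpos_right h1 hε) (norm_nonneg x))
  exact LinearMap.injective_iff_surjective.1 hinj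

end Pseudospectrum

/-! ### Finite sections and infinite operators as problems on `ℤ` -/

/-- The function `(A - z) f` on `ℤ`, where `A` is the bi-infinite matrix `hopMatrix c`. -/
def hopResid (c : ℤ → ℤˣ) (z : ℂ) (f : ℤ → ℂ) (i : ℤ) : ℂ :=
  f (i + 1) + (((c (i - 1) : ℤˣ) : ℤ) : ℂ) * f (i - 1) - z * f i

/-- The points `z` for which the section of `hopMatrix c` to `{l, …, m}` has an `ε`-approximate
eigenvector. -/
def sectionPseudospectrum (p : ℝ≥0∞) (ε : ℝ) (c : ℤ → ℤˣ) (l m : ℤ) : Set ℂ :=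
  {z | ∃ f : ℤ → ℂ, (∀ i, i ∉ Set.Icc l m → f i = 0) ∧
    lpENorm p ((Set.Icc l m).indicator (hopResid c z f)) < ENNReal.ofReal ε * lpENorm p f}

theorem norm_sign_mul (u : ℤˣ) (a : ℂ) : ‖((u : ℤ) : ℂ) * a‖ = ‖a‖ := by
  rcases Int.units_eq_one_or u with h | h <;> simp [h]

theorem norm_lt_iff_enorm_lt {E F : Type} [NormedAddCommGroup E] [NormedAddCommGroup F] {ε : ℝ}
    (hε : 0 < ε) (x : E) (y : F) : ‖x‖ < ε * ‖y‖ ↔ ‖x‖ₑ < ENNReal.ofReal ε * ‖y‖ₑ := by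
  rw [← ofReal_norm, ← ofReal_norm, ← ENNReal.ofReal_mul hε.le]
  refine ⟨fun h => ?_, fun h => ?_⟩
  · exact (ENNReal.ofReal_lt_ofReal_iff ((norm_nonneg x).trans_lt h)).2 h
  · exact (ENNReal.ofReal_lt_ofReal_iff_of_nonneg (norm_nonneg x)).1 h

theorem sum_ite_mul_eq {ι : Type} [Fintype ι] {g : ι → ℤ} (hg : g.Injective) {f : ℤ → ℂ}
    (hf : ∀ k, k ∉ Set.range g → f k = 0) (u : ℤ → ℂ) (k : ℤ) :
    ∑ j, (if k = g j then u (g j) else 0) * f (g j) = u k * f k := by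
  by_cases hk : k ∈ Set.range g
  · obtain ⟨j, rfl⟩ := hk
    rw [Finset.sum_eq_single j]
    · simp
    · intro i _ hi
      rw [if_neg (fun h => hi (hg h).symm), zero_mul]
    · simp
  · rw [hf k hk, mul_zero]
    refine Finset.sum_eq_zero fun j _ => ?_
    rw [if_neg (fun h => hk ⟨j, h.symm⟩), zero_mul]

theorem pseudospectrum_matOp {p : ℝ≥0∞} [Fact (1 ≤ p)] {ε : ℝ} (hε : 0 < ε) {ι : Type} [Fintype ι]
    [DecidableEq ι] {M : Matrix ι ι ℂ} {g : ι → ℤ} (hg : g.Injective) {l m : ℤ}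
    (hr : Set.range g = Set.Icc l m) {c : ℤ → ℤˣ}
    (hM : ∀ i j, M i j = (if g i - 1 = g j then (((c (g j) : ℤˣ) : ℤ) : ℂ) else 0) +
      (if g i + 1 = g j then 1 else 0)) :
    pseudospectrum ε (matOp p M) = sectionPseudospectrum p ε c l m := by
  have hp0 : p ≠ 0 := (zero_lt_one.trans_le (Fact.out : 1 ≤ p)).ne'
  ext z
  have key : ∀ (x : PiLp p (fun _ : ι => ℂ)) (f : ℤ → ℂ), (∀ i, i ∉ Set.Icc l m → f i = 0) →
      (∀ i, f (g i) = x i) →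
      (‖matOp p M x - z • x‖ < ε * ‖x‖ ↔
        lpENorm p ((Set.Icc l m).indicator (hopResid c z f)) < ENNReal.ofReal ε * lpENorm p f) := by
    intro x f hf hfx
    rw [← hr] at hf ⊢
    rw [norm_lt_iff_enorm_lt hε, enorm_piLp_eq, enorm_piLp_eq, ← lpENorm_comp hp0 hg hf,
      ← lpENorm_comp hp0 hg (f := (Set.range g).indicator (hopResid c z f))
        (fun i hi => Set.indicator_of_notMem hi _)]
    have h1 : ∀ i, (matOp p M x - z • x) i = (Set.range g).indicator (hopResid c z f) (g i) := by
      intro i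
      rw [Set.indicator_of_mem (Set.mem_range_self i), hopResid]
      change (M.mulVec x.ofLp) i - z * x i = _
      have e1 := sum_ite_mul_eq hg hf (fun k => (((c k : ℤˣ) : ℤ) : ℂ)) (g i - 1)
      have e2 := sum_ite_mul_eq hg hf (fun _ => 1) (g i + 1)
      rw [one_mul] at e2
      simp only [Matrix.mulVec, dotProduct, hM, add_mul, Finset.sum_add_distrib]
      rw [← e1, ← e2, hfx]
      simp only [hfx]
      ring
    simp only [h1, hfx]
  rw [mem_pseudospectrum_iff_of_finiteDimensional hε]
  constructor
  · rintro ⟨x, hx⟩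
    have h0 : ∀ i, i ∉ Set.Icc l m → Function.extend g x.ofLp 0 i = 0 := fun i hi =>
      Function.extend_apply' _ _ _ (by rwa [← hr] at hi)
    exact ⟨Function.extend g x.ofLp 0, h0,
      (key x _ h0 fun i => hg.extend_apply _ _ _).1 hx⟩
  · rintro ⟨f, hf, h⟩
    exact ⟨WithLp.toLp p fun i => f (g i), (key _ f hf fun i => rfl).2 h⟩

/-- An index without predecessor loses its subdiagonal term; on `ℤ` the same happens because `f`
vanishes outside the range of `g`, whatever the signs `c` are there. -/
theorem hopOp_sub_apply {p : ℝ≥0∞} [Fact (1 ≤ p)] {S : Type} [Add S] [One S] [DecidableEq S]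
    [IsRightCancelAdd S] {b : S → ℤˣ} {g : S → ℤ} (hg : g.Injective)
    (hg1 : ∀ i, g (i + 1) = g i + 1) {c : ℤ → ℤˣ} (hc : ∀ i, c (g i) = b i)
    (x : lp (fun _ : S => ℂ) p) {f : ℤ → ℂ} (hf : ∀ i, i ∉ Set.range g → f i = 0)
    (hfx : ∀ i, f (g i) = x i) (z : ℂ) (i : S) :
    (hopOp p b x - z • x) i = hopResid c z f (g i) := by
  have h1 : (hopOp p b x) i = _ := (hop_hasSum b x i).tsum_eq
  change (hopOp p b x) i - z * x i = _
  rw [h1, hopResid, ← hg1, hfx, hfx]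
  congr 2
  by_cases hi : ∃ k : S, k + 1 = i
  · obtain ⟨k, rfl⟩ := hi
    rw [succ_injective.extend_apply, hg1, add_sub_cancel_right, hc, hfx]
  · rw [Function.extend_apply' _ _ _ hi, hf (g i - 1), mul_zero, Pi.zero_apply]
    rintro ⟨k, hk⟩
    exact hi ⟨k, hg (by rw [hg1, hk]; ring)⟩

theorem lpENorm_shift {p : ℝ≥0∞} (hp0 : p ≠ 0) (f : ℤ → ℂ) (k : ℤ) :
    lpENorm p (fun i => f (i + k)) = lpENorm p f :=
  lpENorm_comp hp0 (φ := fun i : ℤ => i + k) (add_left_injective k)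
    fun i hi => absurd ⟨i - k, by simp⟩ hi

/-! ### Solving the infinite system by finite sections -/

theorem exists_section_solution {p : ℝ≥0∞} (hp0 : p ≠ 0) {ε : ℝ} (hε : 0 < ε) {c : ℤ → ℤˣ} {z : ℂ}
    {l m : ℤ} (hz : z ∉ sectionPseudospectrum p ε c l m) (y : ℤ → ℂ) :
    ∃ f : ℤ → ℂ, (∀ i, i ∉ Set.Icc l m → f i = 0) ∧ (∀ i ∈ Set.Icc l m, hopResid c z f i = y i) ∧
      ENNReal.ofReal ε * lpENorm p f ≤ lpENorm p y := by
  classical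
  let e : (Set.Icc l m → ℂ) → ℤ → ℂ := fun x k => if h : k ∈ Set.Icc l m then x ⟨k, h⟩ else 0
  have he0 : ∀ x i, i ∉ Set.Icc l m → e x i = 0 := fun x i hi => dif_neg hi
  have head : ∀ x y i, e (x + y) i = e x i + e y i := fun x y i => by
    by_cases h : i ∈ Set.Icc l m <;> simp only [e, h, dite_true, dite_false, Pi.add_apply, add_zero]
  have hesm : ∀ (a : ℂ) x i, e (a • x) i = a * e x i := fun a x i => by
    by_cases h : i ∈ Set.Icc l m <;>
      simp only [e, h, dite_true, dite_false, Pi.smul_apply, mul_zero, smul_eq_mul]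
  let L : (Set.Icc l m → ℂ) →ₗ[ℂ] (Set.Icc l m → ℂ) :=
    { toFun := fun x i => hopResid c z (e x) i
      map_add' := fun x y => funext fun i => by
        simp only [hopResid, head, Pi.add_apply]; ring
      map_smul' := fun a x => funext fun i => by
        simp only [hopResid, hesm, Pi.smul_apply, smul_eq_mul, RingHom.id_apply]; ring }
  have hbound : ∀ f : ℤ → ℂ, (∀ i, i ∉ Set.Icc l m → f i = 0) →
      ENNReal.ofReal ε * lpENorm p f ≤ lpENorm p ((Set.Icc l m).indicator (hopResid c z f)) :=
    fun f hf => not_lt.1 fun h => hz ⟨f, hf, h⟩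
  have hinj : Function.Injective L := by
    refine (injective_iff_map_eq_zero _).2 fun x hx => ?_
    have h1 := hbound (e x) (he0 x)
    have h2 : (Set.Icc l m).indicator (hopResid c z (e x)) = 0 := by
      funext i
      by_cases hi : i ∈ Set.Icc l m
      · rw [Set.indicator_of_mem hi]
        exact congrFun hx ⟨i, hi⟩
      · exact Set.indicator_of_notMem hi _
    rw [h2, lpENorm_zero, nonpos_iff_eq_zero, mul_eq_zero, lpENorm_eq_zero hp0] at h1
    have h3 := h1.resolve_left (by simpa using hε)
    funext i
    have h4 : e x i = 0 := congrFun h3 i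
    exact (dif_pos i.2).symm.trans h4
  obtain ⟨x, hx⟩ := LinearMap.injective_iff_surjective.1 hinj (fun i => y i)
  have hxi : ∀ i ∈ Set.Icc l m, hopResid c z (e x) i = y i := fun i hi => congrFun hx ⟨i, hi⟩
  refine ⟨e x, he0 x, hxi, (hbound _ (he0 x)).trans (lpENorm_mono fun i => ?_)⟩
  by_cases hi : i ∈ Set.Icc l m
  · rw [Set.indicator_of_mem hi, hxi i hi]
  · rw [Set.indicator_of_notMem hi, norm_zero]
    exact norm_nonneg _

theorem exists_solution {p : ℝ≥0∞} (hp0 : p ≠ 0) {ε : ℝ} (hε : 0 < ε) {c : ℤ → ℤˣ} {z : ℂ}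
    (hz : ∀ l m, z ∉ sectionPseudospectrum p ε c l m) {U : Set ℤ} {l m : ℕ → ℤ}
    (hU : ∀ n, Set.Icc (l n) (m n) ⊆ U)
    (hlm : ∀ i ∈ U, ∀ᶠ n in Filter.atTop, i ∈ Set.Icc (l n) (m n))
    {y : ℤ → ℂ} (hy : lpENorm p y ≠ ∞) :
    ∃ f : ℤ → ℂ, (∀ i, i ∉ U → f i = 0) ∧ (∀ i ∈ U, hopResid c z f i = y i) ∧
      ENNReal.ofReal ε * lpENorm p f ≤ lpENorm p y := by
  choose F hF0 hFy hFb using fun n => exists_section_solution hp0 hε (hz (l n) (m n)) y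
  have hε0 : ENNReal.ofReal ε ≠ 0 := by simpa using hε
  have hC : ∀ n, lpENorm p (F n) ≤ lpENorm p y / ENNReal.ofReal ε := fun n => by
    rw [ENNReal.le_div_iff_mul_le (Or.inl hε0) (Or.inl ENNReal.ofReal_ne_top), mul_comm]
    exact hFb n
  have hCtop : lpENorm p y / ENNReal.ofReal ε ≠ ∞ := ENNReal.div_ne_top hy hε0
  -- The section solutions are bounded coordinatewise, so a subsequence converges pointwise. The
  -- residual at `i` involves three coordinates only, hence passes to the limit.
  have hK : IsCompact (Set.univ.pi fun _ : ℤ =>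
      Metric.closedBall (0 : ℂ) (lpENorm p y / ENNReal.ofReal ε).toReal) :=
    isCompact_univ_pi fun _ => isCompact_closedBall _ _
  obtain ⟨f, -, φ, hφ, hlim⟩ := hK.tendsto_subseq (x := F) fun n i _ => by
    have := ENNReal.toReal_mono hCtop ((enorm_le_lpENorm hp0 (F n) i).trans (hC n))
    simpa using this
  rw [tendsto_pi_nhds] at hlim
  refine ⟨f, fun i hi => ?_, fun i hi => ?_, ?_⟩
  · refine tendsto_nhds_unique (hlim i) ?_
    have : ∀ n, F (φ n) i = 0 := fun n => hF0 _ i fun h => hi (hU _ h)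
    simp [this]
  · have h1 : Filter.Tendsto (fun n => hopResid c z (F (φ n)) i) Filter.atTop
        (𝓝 (hopResid c z f i)) :=
      ((hlim (i + 1)).add ((hlim (i - 1)).const_mul _)).sub ((hlim i).const_mul z)
    refine tendsto_nhds_unique h1 (Filter.Tendsto.congr' ?_ tendsto_const_nhds)
    filter_upwards [hφ.tendsto_atTop.eventually (hlm i hi)] with n hn
    exact (hFy _ i hn).symm
  · have h1 := lpENorm_le_of_tendsto (p := p) hlim fun n => hC (φ n)
    rwa [ENNReal.le_div_iff_mul_le (Or.inl hε0) (Or.inl ENNReal.ofReal_ne_top), mul_comm] at h1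

/-! ### Uniqueness of bounded solutions by exponential weights -/

theorem abs_pow_natAbs_sub_le {r : ℝ} (hr0 : 0 < r) (hr1 : r ≤ 1) (i j : ℤ)
    (hij : j = i + 1 ∨ j = i - 1) :
    |r ^ i.natAbs - r ^ j.natAbs| ≤ (1 / r - 1) * r ^ j.natAbs := by
  have hd : 1 - r ≤ 1 / r - 1 := by
    rw [div_sub_one hr0.ne', le_div_iff₀ hr0]
    nlinarith
  have h : i.natAbs = j.natAbs + 1 ∨ j.natAbs = i.natAbs + 1 := by omega
  rcases h with h | h
  · rw [h, pow_succ, abs_sub_comm, abs_of_nonneg]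
    · have := mul_le_mul_of_nonneg_right hd (pow_pos hr0 j.natAbs).le
      linarith
    · have := mul_le_mul_of_nonneg_left hr1 (pow_pos hr0 j.natAbs).le
      linarith
  · have e : (1 / r - 1) * r ^ j.natAbs = r ^ i.natAbs - r ^ j.natAbs := by
      rw [h, pow_succ]
      field_simp
    rw [e, abs_of_nonneg]
    rw [h, pow_succ]
    have := mul_le_mul_of_nonneg_left hr1 (pow_pos hr0 i.natAbs).le
    linarith

/-- The lower bound for the section is applied to `f` cut off to the section and multiplied by `r ^
|i - i₀|`. Its residual consists of the commutator with the weight, which is small, and of the two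
neighbours cut off at the ends. -/
theorem norm_le_of_hopResid_eq_zero {p : ℝ≥0∞} (hp : 1 ≤ p) {ε : ℝ} (hε : 0 < ε) {c : ℤ → ℤˣ}
    {z : ℂ} {l m : ℤ} (hz : z ∉ sectionPseudospectrum p ε c l m) {f : ℤ → ℂ}
    (hf : ∀ i ∈ Set.Icc l m, hopResid c z f i = 0) {i₀ : ℤ} (hi₀ : i₀ ∈ Set.Icc l m) {r : ℝ}
    (hr0 : 0 < r) (hr1 : r ≤ 1) (hr : 1 / r - 1 ≤ ε / 4) :
    ε / 2 * ‖f i₀‖ ≤ r ^ (l - i₀).natAbs * ‖f (l - 1)‖ + r ^ (m - i₀).natAbs * ‖f (m + 1)‖ := by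
  have hp0 : p ≠ 0 := (zero_lt_one.trans_le hp).ne'
  set d : ℝ := 1 / r - 1 with hd
  have hd0 : 0 ≤ d := by
    rw [hd, sub_nonneg, le_div_iff₀ hr0, one_mul]
    exact hr1
  let w : ℤ → ℝ := fun i => r ^ (i - i₀).natAbs
  have hw0 : ∀ i, 0 < w i := fun i => pow_pos hr0 _
  have hw : ∀ i j, (j = i + 1 ∨ j = i - 1) → |w j - w i| ≤ d * w j := fun i j h => by
    rw [abs_sub_comm]
    exact abs_pow_natAbs_sub_le hr0 hr1 (i - i₀) (j - i₀) (by omega)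
  let v : ℤ → ℂ := (Set.Icc l m).indicator fun i => (w i : ℂ) * f i
  have hv0 : ∀ i, i ∉ Set.Icc l m → v i = 0 := fun i hi => Set.indicator_of_notMem hi _
  have hv1 : ∀ i, i ∈ Set.Icc l m → v i = w i * f i := fun i hi => Set.indicator_of_mem hi _
  have hnv : ∀ i, i ∈ Set.Icc l m → ‖v i‖ = w i * ‖f i‖ := fun i hi => by
    rw [hv1 i hi, norm_mul, Complex.norm_real, Real.norm_eq_abs, abs_of_pos (hw0 i)]
  have hvtop : lpENorm p v ≠ ∞ := lpENorm_ne_top_of_support_subset hp0 (Set.finite_Icc l m) hv0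
  have hstep : ∀ i j, (j = i + 1 ∨ j = i - 1) → j ∈ Set.Icc l m →
      ‖v j - w i * f j‖ ≤ d * ‖v j‖ := fun i j h hj => by
    rw [hnv j hj, hv1 j hj, ← sub_mul, norm_mul, ← Complex.ofReal_sub, Complex.norm_real,
      Real.norm_eq_abs, ← mul_assoc]
    exact mul_le_mul_of_nonneg_right (hw i j h) (norm_nonneg _)
  let R : ℝ := w m * ‖f (m + 1)‖
  let L : ℝ := w l * ‖f (l - 1)‖
  have hR0 : 0 ≤ R := mul_nonneg (hw0 m).le (norm_nonneg _)
  have hL0 : 0 ≤ L := mul_nonneg (hw0 l).le (norm_nonneg _)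
  -- Pointwise majorant of the residual of `v`: two shifts of `|v|` from the commutator, and point
  -- masses at `m` and `l` from the cut-off.
  let G : ℤ → ℂ := ((d : ℂ) • (fun i => (‖v (i + 1)‖ : ℂ)) +
      (d : ℂ) • (fun i => (‖v (i + -1)‖ : ℂ))) +
    (Pi.single m (R : ℂ) + Pi.single l (L : ℂ))
  have hG : ∀ i, ‖G i‖ = d * ‖v (i + 1)‖ + d * ‖v (i - 1)‖ +
      ((if i = m then R else 0) + (if i = l then L else 0)) := by
    intro i
    have : G i = ((d * ‖v (i + 1)‖ + d * ‖v (i - 1)‖ +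
      ((if i = m then R else 0) + (if i = l then L else 0)) : ℝ) : ℂ) := by
      simp only [G, Pi.add_apply, Pi.smul_apply, smul_eq_mul, Pi.single_apply, ← sub_eq_add_neg]
      push_cast
      split_ifs <;> simp
    rw [this, Complex.norm_real, Real.norm_eq_abs, abs_of_nonneg]
    split_ifs <;> positivity
  have hpt : ∀ i, ‖(Set.Icc l m).indicator (hopResid c z v) i‖ ≤ ‖G i‖ := by
    intro i
    by_cases hi : i ∈ Set.Icc l m
    swap
    · rw [Set.indicator_of_notMem hi, norm_zero]; exact norm_nonneg _
    -- Subtracting `w i` times the vanishing residual of `f` removes the diagonal term.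
    have e : hopResid c z v i = (v (i + 1) - w i * f (i + 1)) +
        (((c (i - 1) : ℤˣ) : ℤ) : ℂ) * (v (i - 1) - w i * f (i - 1)) := by
      have h1 := hf i hi
      rw [hopResid] at h1 ⊢
      rw [hv1 i hi]
      linear_combination (w i : ℂ) * h1
    have b1 : ‖v (i + 1) - w i * f (i + 1)‖ ≤ d * ‖v (i + 1)‖ + if i = m then R else 0 := by
      by_cases h : i + 1 ∈ Set.Icc l m
      · have := hstep i (i + 1) (Or.inl rfl) h
        split_ifs <;> linarith
      · have him : i = m := by
          simp only [Set.mem_Icc] at hi h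
          omega
        rw [if_pos him, hv0 _ h, him, zero_sub, norm_neg, norm_mul, Complex.norm_real,
          Real.norm_eq_abs, abs_of_pos (hw0 m), norm_zero, mul_zero, zero_add]
    have b2 : ‖v (i - 1) - w i * f (i - 1)‖ ≤ d * ‖v (i - 1)‖ + if i = l then L else 0 := by
      by_cases h : i - 1 ∈ Set.Icc l m
      · have := hstep i (i - 1) (Or.inr rfl) h
        split_ifs <;> linarith
      · have him : i = l := by
          simp only [Set.mem_Icc] at hi h
          omega
        rw [if_pos him, hv0 _ h, him, zero_sub, norm_neg, norm_mul, Complex.norm_real,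
          Real.norm_eq_abs, abs_of_pos (hw0 l), norm_zero, mul_zero, zero_add]
    rw [Set.indicator_of_mem hi, e, hG]
    refine (norm_add_le _ _).trans ?_
    rw [norm_sign_mul]
    linarith
  have hshift : ∀ k : ℤ, lpENorm p (fun i => (‖v (i + k)‖ : ℂ)) = lpENorm p v := fun k => by
    rw [← lpENorm_shift hp0 v k]
    exact lpENorm_congr_norm fun i => by simp
  have h1 : ENNReal.ofReal ε * lpENorm p v ≤
      ENNReal.ofReal d * lpENorm p v + ENNReal.ofReal d * lpENorm p v +
        (ENNReal.ofReal R + ENNReal.ofReal L) := by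
    have en : ∀ a : ℝ, 0 ≤ a → ‖(a : ℂ)‖ₑ = ENNReal.ofReal a := fun a ha => by
      rw [← ofReal_norm, Complex.norm_real, Real.norm_eq_abs, abs_of_nonneg ha]
    refine (not_lt.1 fun h => hz ⟨v, hv0, h⟩).trans ((lpENorm_mono hpt).trans ?_)
    refine (lpENorm_add_le hp _ _).trans (add_le_add ((lpENorm_add_le hp _ _).trans ?_)
      ((lpENorm_add_le hp _ _).trans ?_))
    · rw [lpENorm_const_smul, lpENorm_const_smul, hshift, hshift, en d hd0]
    · rw [lpENorm_single hp0, lpENorm_single hp0, en R hR0, en L hL0]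
  have h2 : ε * (lpENorm p v).toReal ≤ d * (lpENorm p v).toReal + d * (lpENorm p v).toReal +
      (R + L) := by
    rw [← ENNReal.ofReal_toReal hvtop, ← ENNReal.ofReal_mul hε.le, ← ENNReal.ofReal_mul hd0,
      ← ENNReal.ofReal_add (by positivity) (by positivity), ← ENNReal.ofReal_add hR0 hL0,
      ← ENNReal.ofReal_add (by positivity) (by positivity),
      ENNReal.ofReal_le_ofReal_iff (by positivity)] at h1
    exact h1
  have h3 : ‖f i₀‖ ≤ (lpENorm p v).toReal := by
    have := ENNReal.toReal_mono hvtop (enorm_le_lpENorm hp0 v i₀)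
    rw [toReal_enorm, hnv i₀ hi₀] at this
    simpa [w] using this
  -- The two shifts cost at most `ε / 4` each, so `ε / 2` of the lower bound survives.
  have h4 : d * (lpENorm p v).toReal ≤ ε / 4 * (lpENorm p v).toReal :=
    mul_le_mul_of_nonneg_right hr ENNReal.toReal_nonneg
  have h5 : ε / 2 * ‖f i₀‖ ≤ ε / 2 * (lpENorm p v).toReal :=
    mul_le_mul_of_nonneg_left h3 (by positivity)
  have h6 : R + L = r ^ (l - i₀).natAbs * ‖f (l - 1)‖ + r ^ (m - i₀).natAbs * ‖f (m + 1)‖ :=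
    add_comm _ _
  linarith

/-- Around `i` there are intervals each of whose ends either has distance `n` from `i`, where the
weight is `r ^ n`, or borders the complement of `U`, where `f` is zero. Letting `n → ∞` kills the
weighted estimate. -/
theorem eq_zero_of_hopResid_eq_zero {p : ℝ≥0∞} (hp : 1 ≤ p) {ε : ℝ} (hε : 0 < ε) {c : ℤ → ℤˣ}
    {z : ℂ} (hz : ∀ l m, z ∉ sectionPseudospectrum p ε c l m) {U : Set ℤ}
    (hU : ∀ i ∈ U, ∀ n : ℕ, ∃ l m, Set.Icc l m ⊆ U ∧ i ∈ Set.Icc l m ∧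
      (l - 1 ∈ U → l = i - n) ∧ (m + 1 ∈ U → m = i + n))
    {f : ℤ → ℂ} (hf0 : ∀ i, i ∉ U → f i = 0) (hf : ∀ i ∈ U, hopResid c z f i = 0) {C : ℝ}
    (hC : ∀ i, ‖f i‖ ≤ C) (i : ℤ) : f i = 0 := by
  by_cases hi : i ∈ U
  swap
  · exact hf0 i hi
  have hC0 : 0 ≤ C := (norm_nonneg _).trans (hC 0)
  set r : ℝ := 1 / (1 + ε / 4) with hr
  have hr0 : 0 < r := by positivity
  have hr1 : r < 1 := by
    rw [hr, div_lt_one (by positivity)]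
    linarith
  have hr2 : 1 / r - 1 ≤ ε / 4 := by rw [hr]; simp
  have hb : ∀ n : ℕ, ε / 2 * ‖f i‖ ≤ r ^ n * (2 * C) := by
    intro n
    obtain ⟨l, m, hlm, him, hl, hm⟩ := hU i hi n
    refine (norm_le_of_hopResid_eq_zero hp hε (hz l m) (fun j hj => hf j (hlm hj)) him hr0 hr1.le
      hr2).trans ?_
    have e1 : r ^ (l - i).natAbs * ‖f (l - 1)‖ ≤ r ^ n * C := by
      by_cases h : l - 1 ∈ U
      · rw [hl h, show (i - (n : ℤ) - i).natAbs = n by omega]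
        exact mul_le_mul_of_nonneg_left (hC _) (by positivity)
      · rw [hf0 _ h, norm_zero, mul_zero]
        positivity
    have e2 : r ^ (m - i).natAbs * ‖f (m + 1)‖ ≤ r ^ n * C := by
      by_cases h : m + 1 ∈ U
      · rw [hm h, show (i + (n : ℤ) - i).natAbs = n by omega]
        exact mul_le_mul_of_nonneg_left (hC _) (by positivity)
      · rw [hf0 _ h, norm_zero, mul_zero]
        positivity
    linarith
  have hlim : Filter.Tendsto (fun n : ℕ => r ^ n * (2 * C)) Filter.atTop (𝓝 0) := by
    simpa using (tendsto_pow_atTop_nhds_zero_of_lt_one hr0.le hr1).mul_const (2 * C)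
  have h1 := ge_of_tendsto' hlim hb
  exact norm_eq_zero.1 (le_antisymm (nonpos_of_mul_nonpos_right h1 (by positivity)) (norm_nonneg _))

theorem exists_mem_sectionPseudospectrum_of_mem_pseudospectrum_hopOp {p : ℝ≥0∞} [Fact (1 ≤ p)]
    {ε : ℝ} (hε : 0 < ε) {S : Type} [Add S] [One S] [DecidableEq S] [IsRightCancelAdd S]
    {b : S → ℤˣ} {g : S → ℤ} (hg : g.Injective) (hg1 : ∀ i, g (i + 1) = g i + 1)
    {c : ℤ → ℤˣ} (hc : ∀ i, c (g i) = b i)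
    (hU : ∀ i ∈ Set.range g, ∀ n : ℕ, ∃ l m, Set.Icc l m ⊆ Set.range g ∧ i ∈ Set.Icc l m ∧
      (l - 1 ∈ Set.range g → l = i - n) ∧ (m + 1 ∈ Set.range g → m = i + n))
    {l m : ℕ → ℤ} (hlm : ∀ n, Set.Icc (l n) (m n) ⊆ Set.range g)
    (hlm' : ∀ i ∈ Set.range g, ∀ᶠ n in Filter.atTop, i ∈ Set.Icc (l n) (m n))
    {z : ℂ} (hz : z ∈ pseudospectrum ε (hopOp p b)) :
    ∃ l m, z ∈ sectionPseudospectrum p ε c l m := by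
  have hp : 1 ≤ p := Fact.out
  have hp0 : p ≠ 0 := (zero_lt_one.trans_le hp).ne'
  by_contra! H
  have hext : ∀ x : lp (fun _ : S => ℂ) p, ∃ f : ℤ → ℂ, (∀ i, i ∉ Set.range g → f i = 0) ∧
      (∀ i, f (g i) = x i) ∧ lpENorm p f = ‖x‖ₑ := fun x => by
    have h0 : ∀ i, i ∉ Set.range g → Function.extend g x 0 i = 0 := fun i hi =>
      Function.extend_apply' _ _ _ hi
    have h1 : ∀ i, Function.extend g x 0 (g i) = x i := fun i => hg.extend_apply _ _ _
    refine ⟨Function.extend g x 0, h0, h1, ?_⟩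
    rw [enorm_lp_eq, ← lpENorm_comp hp0 hg h0]
    simp only [h1]
  have hsol : ∀ y : lp (fun _ : S => ℂ) p, ∃ x : lp (fun _ : S => ℂ) p,
      hopOp p b x - z • x = y ∧ ε * ‖x‖ ≤ ‖y‖ := by
    intro y
    obtain ⟨y', hy0, hy1, hy2⟩ := hext y
    obtain ⟨f, hf0, hf1, hf2⟩ := exists_solution hp0 hε H hlm hlm' (y := y')
      (by rw [hy2]; exact enorm_ne_top)
    rw [← lpENorm_comp hp0 hg hf0, hy2] at hf2
    have hmem : Memℓp (fun i => f (g i)) p := by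
      refine memℓp_of_lpENorm_ne_top hp0 fun h => ?_
      rw [h, ENNReal.mul_top (by simpa using hε), top_le_iff] at hf2
      exact enorm_ne_top hf2
    refine ⟨⟨_, hmem⟩, lp.ext (funext fun i => ?_), ?_⟩
    · rw [hopOp_sub_apply hg hg1 hc _ hf0 (fun _ => rfl), hf1 _ ⟨i, rfl⟩, hy1]
    · refine not_lt.1 fun h => not_lt.2 hf2 ?_
      have h2 := enorm_lp_eq (⟨_, hmem⟩ : lp (fun _ : S => ℂ) p)
      exact h2 ▸ (norm_lt_iff_enorm_lt hε y _).1 h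
  have hker : ∀ x : lp (fun _ : S => ℂ) p, hopOp p b x - z • x = 0 → x = 0 := by
    intro x hx
    obtain ⟨f, hf0, hf1, -⟩ := hext x
    refine lp.ext (funext fun i => ?_)
    rw [← hf1 i]
    refine eq_zero_of_hopResid_eq_zero hp hε H hU hf0 ?_ (C := ‖x‖) (fun j => ?_) (g i)
    · rintro _ ⟨k, rfl⟩
      rw [← hopOp_sub_apply hg hg1 hc x hf0 hf1, hx]
      rfl
    · by_cases hj : j ∈ Set.range g
      · obtain ⟨k, rfl⟩ := hj
        rw [hf1]
        exact lp.norm_apply_le_norm hp0 x k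
      · rw [hf0 j hj, norm_zero]
        exact norm_nonneg x
  refine notMem_pseudospectrum hε (fun y => (hsol y).imp fun x h => h.1) (fun x => ?_) hz
  -- By uniqueness the constructed solution is `x` itself, so its norm bound holds for every `x`.
  obtain ⟨x', h1, h2⟩ := hsol (hopOp p b x - z • x)
  have h3 : x' - x = 0 := hker _ (by
    rw [← sub_eq_zero] at h1
    rw [map_sub, smul_sub, ← h1]
    abel)
  rwa [sub_eq_zero.1 h3] at h2

/-! ### From a section to a finitely supported approximate eigenvector -/

theorem hopResid_shift (c : ℤ → ℤˣ) (z : ℂ) (f : ℤ → ℂ) (k i : ℤ) :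
    hopResid (fun i => c (i + k)) z (fun i => f (i + k)) i = hopResid c z f (i + k) := by
  simp only [hopResid]
  rw [show i + 1 + k = i + k + 1 by ring, show i - 1 + k = i + k - 1 by ring]

theorem lpENorm_natAbs {p : ℝ≥0∞} (hp0 : p ≠ 0) {u : ℤ → ℂ} (hu : ∀ i, i ≤ 0 → u i = 0) :
    lpENorm p (fun i : ℤ => u i.natAbs) = lpENorm p (1 : Bool → ℂ) * lpENorm p u := by
  let φ : Bool × ℕ → ℤ := fun q => if q.1 then (q.2 : ℤ) + 1 else -((q.2 : ℤ) + 1)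
  have hφ : φ.Injective := by
    rintro ⟨b, n⟩ ⟨b', n'⟩ h
    cases b <;> cases b' <;> simp [φ] at h ⊢ <;> omega
  have hr : ∀ i, i ∉ Set.range φ → u i.natAbs = 0 := by
    intro i hi
    refine hu _ ?_
    by_contra h
    refine hi ⟨(decide (0 < i), i.natAbs - 1), ?_⟩
    by_cases h' : 0 < i <;> simp [φ, h'] <;> omega
  have hψ : Function.Injective fun n : ℕ => (n : ℤ) + 1 := fun a b h => by simpa using h
  rw [← lpENorm_comp hp0 hφ hr, ← lpENorm_comp hp0 hψ (f := u), ← lpENorm_mul_prod hp0]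
  · refine lpENorm_congr_norm fun q => ?_
    have : ((φ q).natAbs : ℤ) = q.2 + 1 := by
      obtain ⟨b, n⟩ := q
      cases b <;> simp only [φ, Bool.false_eq_true, if_true, if_false] <;> omega
    rw [this]
    simp
  · intro i hi
    refine hu _ ?_
    by_contra h
    exact hi ⟨(i - 1).toNat, by simp; omega⟩

/-- Reflection of an approximate eigenvector of a section: on `{-N, …, N}` there is an approximate
eigenvector, of the section with other signs, whose end values have the same modulus. -/
theorem exists_reflected {p : ℝ≥0∞} (hp0 : p ≠ 0) {ε : ℝ} {c : ℤ → ℤˣ} {z : ℂ} {N : ℕ}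
    {f : ℤ → ℂ} (hf0 : ∀ i, i ∉ Set.Icc 1 (N : ℤ) → f i = 0)
    (hf : lpENorm p ((Set.Icc 1 (N : ℤ)).indicator (hopResid c z f)) <
      ENNReal.ofReal ε * lpENorm p f) :
    ∃ (c' : ℤ → ℤˣ) (g : ℤ → ℂ), (∀ i, i ∉ Set.Icc (-N : ℤ) N → g i = 0) ∧ ‖g (-N)‖ = ‖g N‖ ∧
      lpENorm p ((Set.Icc (-N : ℤ) N).indicator (hopResid c' z g)) <
        ENNReal.ofReal ε * lpENorm p g := by
  -- These signs are the diagonal similarity that moves the subdiagonal entries, turned into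
  -- superdiagonal ones by the reflection, back below the diagonal.
  let s : ℕ → ℤˣ := fun n => ∏ k ∈ Finset.range n, c k
  have hs : ∀ n, s (n + 1) = s n * c n := fun n => Finset.prod_range_succ _ n
  let g : ℤ → ℂ := fun i => if 0 ≤ i then f i else (((s i.natAbs : ℤˣ) : ℤ) : ℂ) * f i.natAbs
  -- The value at `-1` is forced by the row `0`: `f 1 + c' (-1) * (c 0 * f 1) = 0`.
  let c' : ℤ → ℤˣ := fun i => if 0 ≤ i then c i else if i = -1 then -c 0 else c (-i - 1)
  have hf00 : f 0 = 0 := hf0 0 (by simp)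
  have hgpos : ∀ i : ℤ, 0 ≤ i → g i = f i := fun i hi => if_pos hi
  have hgneg : ∀ n : ℕ, g (-n) = (((s n : ℤˣ) : ℤ) : ℂ) * f n := fun n => by
    rcases Nat.eq_zero_or_pos n with rfl | hn
    · simp [g, hf00]
    · simp only [g]
      rw [if_neg (by omega), Int.natAbs_neg, Int.natAbs_natCast]
  have hgn : ∀ i, ‖g i‖ = ‖f i.natAbs‖ := fun i => by
    by_cases hi : 0 ≤ i
    · rw [hgpos i hi, Int.natAbs_of_nonneg hi]
    · simp only [g, if_neg hi, norm_sign_mul]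
  have sq : ∀ u : ℤˣ, (((u : ℤˣ) : ℤ) : ℂ) * (((u : ℤˣ) : ℤ) : ℂ) = 1 := fun u => by
    rcases Int.units_eq_one_or u with h | h <;> simp [h]
  have hzero : hopResid c' z g 0 = 0 := by
    have h1 := hgneg 1
    have h2 := hs 0
    simp only [Nat.cast_one, zero_add] at h1 h2
    have h3 : s 0 = 1 := rfl
    have h4 : c' (-1) = -c 0 := by simp [c']
    rw [h3, one_mul, Nat.cast_zero] at h2
    rw [hopResid, zero_add, zero_sub, hgpos 0 le_rfl, hgpos 1 zero_le_one, h1, h2, hf00, h4]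
    push_cast
    linear_combination -f 1 * sq (c 0)
  have hposR : ∀ i : ℤ, 0 < i → hopResid c' z g i = hopResid c z f i := fun i hi => by
    have : c' (i - 1) = c (i - 1) := if_pos (by omega)
    rw [hopResid, hopResid, hgpos _ (by omega), hgpos _ (by omega), hgpos _ (by omega), this]
  have hnegR : ∀ n : ℕ, hopResid c' z g (-((n : ℤ) + 1)) =
      (((s (n + 1) : ℤˣ) : ℤ) : ℂ) * hopResid c z f ((n : ℤ) + 1) := fun n => by
    have e1 := hgneg n
    have e2 := hgneg (n + 1)
    have e3 := hgneg (n + 2)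
    have hc : c' (-((n : ℤ) + 1) - 1) = c (n + 1) := by
      simp only [c']
      rw [if_neg (by omega), if_neg (by omega)]
      congr 1
      ring
    rw [hopResid, hopResid, hc, show -((n : ℤ) + 1) + 1 = -n by ring,
      show -((n : ℤ) + 1) - 1 = -((n + 2 : ℕ) : ℤ) by push_cast; ring,
      show -((n : ℤ) + 1) = -((n + 1 : ℕ) : ℤ) by push_cast; ring, e1, e2, e3, hs (n + 1), hs n]
    push_cast
    rw [show (n : ℤ) + 1 + 1 = n + 2 by ring, show (n : ℤ) + 1 - 1 = n by ring]
    linear_combination (((s n : ℤˣ) : ℤ) : ℂ) * (((c n : ℤˣ) : ℤ) : ℂ) * f (n + 2) * sq (c (n + 1))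
      - (((s n : ℤˣ) : ℤ) : ℂ) * f n * sq (c n)
  set ρ := (Set.Icc 1 (N : ℤ)).indicator (hopResid c z f) with hρ
  have hρn : ∀ i, ‖(Set.Icc (-N : ℤ) N).indicator (hopResid c' z g) i‖ = ‖ρ i.natAbs‖ := fun i => by
    rcases lt_trichotomy i 0 with hi | rfl | hi
    · obtain ⟨n, rfl⟩ : ∃ n : ℕ, i = -((n : ℤ) + 1) := ⟨(-i - 1).toNat, by omega⟩
      have hn : (-((n : ℤ) + 1)).natAbs = n + 1 := by omega
      rw [hn, hρ]
      by_cases h : n + 1 ≤ N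
      · rw [Set.indicator_of_mem (by simp only [Set.mem_Icc]; omega),
          Set.indicator_of_mem (by simp only [Set.mem_Icc]; omega), hnegR, norm_sign_mul]
        simp
      · rw [Set.indicator_of_notMem (by simp only [Set.mem_Icc]; omega),
          Set.indicator_of_notMem (by simp only [Set.mem_Icc]; omega)]
    · rw [hρ, Set.indicator_of_mem (by simp), hzero, Set.indicator_of_notMem (by simp)]
    · rw [Int.natAbs_of_nonneg hi.le, hρ]
      by_cases h : i ≤ N
      · rw [Set.indicator_of_mem (by simp only [Set.mem_Icc]; omega),
          Set.indicator_of_mem (by simp only [Set.mem_Icc]; omega), hposR i hi]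
      · rw [Set.indicator_of_notMem (by simp only [Set.mem_Icc]; omega),
          Set.indicator_of_notMem (by simp only [Set.mem_Icc]; omega)]
  refine ⟨c', g, fun i hi => ?_, ?_, ?_⟩
  · rw [← norm_eq_zero, hgn, hf0, norm_zero]
    simp only [Set.mem_Icc] at hi ⊢
    omega
  · rw [hgn, hgn]
    simp
  -- Doubling multiplies the norms of the vector and of the residual by the same factor, so the
  -- strict inequality is preserved.
  · rw [lpENorm_congr_norm hρn, lpENorm_congr_norm hgn, lpENorm_natAbs hp0, lpENorm_natAbs hp0,
      mul_left_comm]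
    · refine ENNReal.mul_lt_mul_right (fun h => ?_) (lpENorm_ne_top_of_finite _) hf
      have := congrFun ((lpENorm_eq_zero hp0).1 h) true
      simp at this
    · exact fun i hi => hf0 i (by simp only [Set.mem_Icc]; omega)
    · exact fun i hi => Set.indicator_of_notMem (by simp only [Set.mem_Icc]; omega) _

/-- A tent of height `2 * K` has slopes at most `1` and is at least `K` on `{-K, …, K}`. Its
differences live on three translates of that interval, so the ratio of norms is at most `3 / K` for
every `p`. -/
theorem exists_slowly_varying {p : ℝ≥0∞} (hp : 1 ≤ p) {δ : ℝ} (hδ : 0 < δ) :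
    ∃ (W : ℤ → ℂ) (K : ℤ), (∀ k, k ∉ Set.Icc (-K) K → W k = 0) ∧ W ≠ 0 ∧
      lpENorm p (fun k => W k - W (k - 1)) ≤ ENNReal.ofReal δ * lpENorm p W := by
  have hp0 : p ≠ 0 := (zero_lt_one.trans_le hp).ne'
  obtain ⟨K, hK⟩ := exists_nat_gt (3 / δ)
  have hK0 : (0 : ℝ) < K := lt_trans (by positivity) hK
  have hK1 : 0 < K := by exact_mod_cast hK0
  let W : ℤ → ℂ := fun k => ((max 0 (2 * (K : ℤ) - k.natAbs) : ℤ) : ℂ)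
  let I : ℤ → ℂ := (Set.Icc (-K : ℤ) K).indicator 1
  have hI : ∀ k : ℤ, ((I k = 1 ∧ -K ≤ k ∧ k ≤ K) ∨ (I k = 0 ∧ ¬ (-K ≤ k ∧ k ≤ K))) := fun k => by
    by_cases h : k ∈ Set.Icc (-K : ℤ) K
    · exact Or.inl ⟨Set.indicator_of_mem h _, h.1, h.2⟩
    · exact Or.inr ⟨Set.indicator_of_notMem h _, h⟩
  have hIr : ∀ k, I k = ((‖I k‖ : ℝ) : ℂ) := fun k => by
    rcases hI k with ⟨h, -⟩ | ⟨h, -⟩ <;> simp [h]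
  refine ⟨W, 2 * K, fun k hk => ?_, fun h => ?_, ?_⟩
  · simp only [W]
    rw [max_eq_left]
    · simp
    · simp only [Set.mem_Icc] at hk
      omega
  · have := congrFun h 0
    simp [W, hK1.ne'] at this
  · have h1 : lpENorm p (fun k => W k - W (k - 1)) ≤
        lpENorm p ((fun k => I (k + -(2 * K))) + ((fun k => I (k + 0)) + fun k => I (k + 2 * K))) := by
      refine lpENorm_mono fun k => ?_
      have e1 : ‖((fun k => I (k + -(2 * K))) + ((fun k => I (k + 0)) + fun k => I (k + 2 * K))) k‖ =
          ‖I (k + -(2 * K))‖ + (‖I (k + 0)‖ + ‖I (k + 2 * K)‖) := by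
        simp only [Pi.add_apply]
        conv_lhs => rw [hIr (k + -(2 * K)), hIr (k + 0), hIr (k + 2 * K), ← Complex.ofReal_add,
          ← Complex.ofReal_add, Complex.norm_real, Real.norm_eq_abs]
        exact abs_of_nonneg (by positivity)
      rw [e1]
      simp only [W]
      rw [← Int.cast_sub, Complex.norm_intCast]
      by_cases hk : -(2 * (K : ℤ)) ≤ k ∧ k ≤ 2 * K
      · have h2 : |(max 0 (2 * (K : ℤ) - k.natAbs) - max 0 (2 * (K : ℤ) - (k - 1).natAbs))| ≤ 1 := by
          rw [abs_le]
          omega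
        have h3 : (1 : ℝ) ≤ ‖I (k + -(2 * K))‖ + (‖I (k + 0)‖ + ‖I (k + 2 * K)‖) := by
          rcases hI (k + -(2 * K)) with ⟨h, -⟩ | ⟨h, h'⟩
          · rw [h, norm_one]
            linarith [norm_nonneg (I (k + 0)), norm_nonneg (I (k + 2 * K))]
          rcases hI (k + 0) with ⟨h, -⟩ | ⟨h, h''⟩
          · rw [h, norm_one]
            linarith [norm_nonneg (I (k + -(2 * K))), norm_nonneg (I (k + 2 * K))]
          rcases hI (k + 2 * K) with ⟨h, -⟩ | ⟨h, h'''⟩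
          · rw [h, norm_one]
            linarith [norm_nonneg (I (k + 0)), norm_nonneg (I (k + -(2 * K)))]
          omega
        refine le_trans ?_ h3
        exact_mod_cast h2
      · have h2 : (max 0 (2 * (K : ℤ) - k.natAbs) - max 0 (2 * (K : ℤ) - (k - 1).natAbs)) = 0 := by
          omega
        rw [h2]
        simp only [Int.cast_zero, abs_zero]
        positivity
    have h2 : lpENorm p (fun k => W k - W (k - 1)) ≤ ENNReal.ofReal 3 * lpENorm p I := by
      refine h1.trans ((lpENorm_add_le hp _ _).trans ?_)
      refine (add_le_add le_rfl (lpENorm_add_le hp _ _)).trans ?_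
      rw [lpENorm_shift hp0, lpENorm_shift hp0, lpENorm_shift hp0]
      refine le_of_eq ?_
      norm_num
      ring
    have h3 : ENNReal.ofReal K * lpENorm p I ≤ lpENorm p W := by
      have : lpENorm p ((K : ℂ) • I) ≤ lpENorm p W := by
        refine lpENorm_mono fun k => ?_
        simp only [Pi.smul_apply, smul_eq_mul, W]
        rcases hI k with ⟨h, h'⟩ | ⟨h, -⟩
        · rw [h, mul_one, Complex.norm_natCast, Complex.norm_intCast]
          have : (K : ℤ) ≤ |max 0 (2 * (K : ℤ) - k.natAbs)| := by
            rw [le_abs]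
            omega
          exact_mod_cast this
        · rw [h, mul_zero, norm_zero]
          exact norm_nonneg _
      rw [lpENorm_const_smul] at this
      simpa [← ofReal_norm] using this
    calc _ ≤ ENNReal.ofReal 3 * lpENorm p I := h2
      _ ≤ ENNReal.ofReal (δ * K) * lpENorm p I := by
          gcongr
          rw [div_lt_iff₀ hδ] at hK
          linarith
      _ = ENNReal.ofReal δ * (ENNReal.ofReal K * lpENorm p I) := by
          rw [ENNReal.ofReal_mul hδ.le, mul_assoc]
      _ ≤ _ := by gcongr

theorem exists_slack {ε : ℝ} {a b : ℝ≥0∞} (hb : b ≠ ∞) (h : a < ENNReal.ofReal ε * b) :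
    ∃ δ : ℝ, 0 < δ ∧ a + ENNReal.ofReal δ * b < ENNReal.ofReal ε * b := by
  have hlim : Filter.Tendsto (fun δ : ℝ => a + ENNReal.ofReal δ * b) (𝓝 0)
      (𝓝 (a + ENNReal.ofReal 0 * b)) :=
    tendsto_const_nhds.add (ENNReal.Tendsto.mul_const
      (ENNReal.continuous_ofReal.tendsto 0) (Or.inr hb))
  have h1 : ∀ᶠ δ : ℝ in 𝓝[>] 0, a + ENNReal.ofReal δ * b < ENNReal.ofReal ε * b :=
    (hlim.eventually (gt_mem_nhds (by simpa using h))).filter_mono nhdsWithin_le_nhds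
  obtain ⟨δ, h2, h3⟩ := (h1.and self_mem_nhdsWithin).exists
  exact ⟨δ, h3, h2⟩

/-- Periodic continuation, with slowly varying weights, of an approximate eigenvector of a section
whose end values have the same modulus. -/
theorem exists_copies {p : ℝ≥0∞} (hp : 1 ≤ p) {ε : ℝ} {c : ℤ → ℤˣ} {z : ℂ} {M : ℕ} (hM : 1 ≤ M)
    {y : ℤ → ℂ} (hy0 : ∀ i, i ∉ Set.Icc 1 (M : ℤ) → y i = 0) (hyM : ‖y 1‖ = ‖y M‖)
    (hy : lpENorm p ((Set.Icc 1 (M : ℤ)).indicator (hopResid c z y)) <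
      ENNReal.ofReal ε * lpENorm p y) :
    ∃ (c' : ℤ → ℤˣ) (l m : ℤ) (f : ℤ → ℂ), (∀ i, i ∉ Set.Icc l m → f i = 0) ∧
      lpENorm p (hopResid c' z f) < ENNReal.ofReal ε * lpENorm p f := by
  have hp0 : p ≠ 0 := (zero_lt_one.trans_le hp).ne'
  have hytop : lpENorm p y ≠ ∞ := lpENorm_ne_top_of_support_subset hp0 (Set.finite_Icc _ _) hy0
  set ρ := (Set.Icc 1 (M : ℤ)).indicator (hopResid c z y) with hρ
  obtain ⟨δ, hδ, hδy⟩ := exists_slack hytop hy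
  obtain ⟨W, K, hWK, hW0, hW⟩ := exists_slowly_varying hp hδ
  have hWtop : lpENorm p W ≠ ∞ := lpENorm_ne_top_of_support_subset hp0 (Set.finite_Icc _ _) hWK
  have hWne : lpENorm p W ≠ 0 := fun h => hW0 ((lpENorm_eq_zero hp0).1 h)
  -- With the factor `α ^ k` on the `k`-th copy, the end of one copy and the start of the next
  -- cancel at the zero between them, up to the change of weight.
  obtain ⟨α, hα, hα1⟩ : ∃ α : ℂ, ‖α‖ = 1 ∧ y M = -(α * y 1) := by
    by_cases h : y 1 = 0
    · refine ⟨1, norm_one, ?_⟩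
      rw [h, norm_zero] at hyM
      rw [h, norm_eq_zero.1 hyM.symm]
      simp
    · refine ⟨-(y M / y 1), ?_, ?_⟩
      · rw [norm_neg, norm_div, hyM, div_self]
        rw [← hyM]
        exact norm_ne_zero_iff.2 h
      · field_simp
  have hα0 : α ≠ 0 := fun h => by simp [h] at hα
  have hαk : ∀ k : ℤ, ‖α ^ k‖ = 1 := fun k => by rw [norm_zpow, hα, one_zpow]
  -- The extra `1` is the zero entry that separates consecutive copies.
  set L : ℤ := (M : ℤ) + 1 with hL
  have hL0 : 0 < L := by omega
  let f : ℤ → ℂ := fun i => W (i / L) * α ^ (i / L) * y (i % L)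
  let c' : ℤ → ℤˣ := fun i => if i % L = M then 1 else c (i % L)
  have hdm : ∀ k j : ℤ, 0 ≤ j → j < L → (L * k + j) / L = k ∧ (L * k + j) % L = j := by
    intro k j h0 h1
    rw [Int.ediv_emod_unique hL0]
    exact ⟨by ring, h0, h1⟩
  have hy00 : y 0 = 0 := hy0 0 (by simp)
  have hyL : y L = 0 := hy0 L (by simp [hL])
  have hf : ∀ k j : ℤ, 0 ≤ j → j ≤ L → f (L * k + j) = W k * α ^ k * y j := by
    intro k j h0 h1
    rcases h1.lt_or_eq with h1 | rfl
    · obtain ⟨e1, e2⟩ := hdm k j h0 h1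
      simp only [f, e1, e2]
    · obtain ⟨-, e2⟩ := hdm (k + 1) 0 le_rfl hL0
      simp only [f]
      rw [show L * k + L = L * (k + 1) + 0 by ring, e2, hy00, hyL, mul_zero, mul_zero]
  have hR0 : ∀ k : ℤ, hopResid c' z f (L * k) = (W k - W (k - 1)) * α ^ k * y 1 := by
    intro k
    have e0 := hf k 0 le_rfl hL0.le
    have e1 := hf k 1 zero_le_one (by omega)
    have e2 := hf (k - 1) M (by omega) (by omega)
    have e3 : c' (L * (k - 1) + M) = 1 := if_pos (hdm (k - 1) M (by omega) (by omega)).2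
    rw [hopResid, e1, show L * k - 1 = L * (k - 1) + M by rw [hL]; ring, e2, e3,
      show L * k = L * k + 0 by ring, e0, hy00, hα1, zpow_sub_one₀ hα0]
    push_cast
    field_simp
    ring
  have hR1 : ∀ k j : ℤ, 1 ≤ j → j ≤ M →
      hopResid c' z f (L * k + j) = W k * α ^ k * ρ j := by
    intro k j h1 h2
    have e0 := hf k j (by omega) (by omega)
    have e1 := hf k (j + 1) (by omega) (by omega)
    have e2 := hf k (j - 1) (by omega) (by omega)
    have e3 : c' (L * k + (j - 1)) = c (j - 1) := by
      have h := (hdm k (j - 1) (by omega) (by omega)).2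
      simp only [c', h]
      rw [if_neg (by omega)]
    rw [hρ, Set.indicator_of_mem (Set.mem_Icc.2 ⟨h1, h2⟩), hopResid, hopResid, e0, add_assoc, e1,
      show L * k + j - 1 = L * k + (j - 1) by ring, e2, e3]
    ring
  let φ : ℤ × Fin (M + 1) → ℤ := fun q => L * q.1 + (q.2 : ℕ)
  have hφb : ∀ j : Fin (M + 1), (0 : ℤ) ≤ (j : ℕ) ∧ ((j : ℕ) : ℤ) < L := fun j => by
    have := j.2
    omega
  have hφ : φ.Injective := by
    rintro ⟨k, j⟩ ⟨k', j'⟩ h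
    obtain ⟨e1, e2⟩ := hdm k (j : ℕ) (hφb j).1 (hφb j).2
    obtain ⟨e1', e2'⟩ := hdm k' (j' : ℕ) (hφb j').1 (hφb j').2
    simp only [φ] at h
    rw [h, e1'] at e1
    rw [h, e2'] at e2
    rw [e1, Fin.ext (by omega : (j : ℕ) = j')]
  have hφs : φ.Surjective := fun i =>
    ⟨(i / L, ⟨(i % L).toNat, by
        have := Int.emod_lt_of_pos i hL0
        omega⟩), by
      have h1 := Int.emod_nonneg i hL0.ne'
      have h2 := Int.mul_ediv_add_emod i L
      simp only [φ]
      omega⟩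
  have hφc : ∀ u : ℤ → ℂ, lpENorm p (fun q => u (φ q)) = lpENorm p u := fun u =>
    lpENorm_comp hp0 hφ fun i hi => absurd (hφs i) hi
  have hψ : Function.Injective fun j : Fin (M + 1) => ((j : ℕ) : ℤ) := fun a b h =>
    Fin.ext (by simpa using h)
  have hψc : ∀ u : ℤ → ℂ, (∀ i, i ∉ Set.Icc 1 (M : ℤ) → u i = 0) →
      lpENorm p (fun j : Fin (M + 1) => u (j : ℕ)) = lpENorm p u := fun u hu => by
    refine lpENorm_comp hp0 hψ fun i hi => hu i fun h => hi ?_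
    simp only [Set.mem_Icc] at h
    exact ⟨⟨i.toNat, by omega⟩, by simp; omega⟩
  have hnf : lpENorm p f = lpENorm p W * lpENorm p y := by
    rw [← hφc f, ← hψc y hy0, ← lpENorm_mul_prod hp0]
    refine lpENorm_congr_norm fun q => ?_
    simp only [φ]
    rw [hf _ _ (hφb q.2).1 (hφb q.2).2.le, norm_mul, norm_mul, hαk, mul_one, norm_mul]
  have hnR : lpENorm p (hopResid c' z f) ≤
      lpENorm p W * lpENorm p ρ + lpENorm p (fun k => W k - W (k - 1)) * ‖y 1‖ₑ := by
    -- The residual is a sum of two tensors up to unimodular factors: `W ⊗ ρ` inside the copies and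
    -- `(W k - W (k - 1)) ⊗ Y` at the joints.
    let Y : Fin (M + 1) → ℂ := Pi.single 0 (y 1)
    have e : (fun q => hopResid c' z f (φ q)) =
        (fun q : ℤ × Fin (M + 1) => W q.1 * α ^ q.1 * ρ (q.2 : ℕ)) +
        fun q : ℤ × Fin (M + 1) => (W q.1 - W (q.1 - 1)) * α ^ q.1 * Y q.2 := by
      funext ⟨k, j⟩
      simp only [Pi.add_apply, φ]
      rcases eq_or_ne j 0 with rfl | hj
      · have h1 : ρ 0 = 0 := by rw [hρ]; exact Set.indicator_of_notMem (by simp) _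
        simp [Y, h1, hR0]
      · have h1 : Y j = 0 := by simp [Y, hj]
        have h2 : (j : ℕ) ≠ 0 := fun h => hj (Fin.ext h)
        have := (hφb j).2
        rw [h1, hR1 k (j : ℕ) (by omega) (by omega), mul_zero, add_zero]
    rw [← hφc, e]
    refine (lpENorm_add_le hp _ _).trans (add_le_add (le_of_eq ?_) (le_of_eq ?_))
    · rw [← hψc ρ fun i hi => Set.indicator_of_notMem hi _, ← lpENorm_mul_prod hp0]
      refine lpENorm_congr_norm fun q => ?_
      rw [norm_mul, norm_mul, hαk, mul_one, norm_mul]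
    · rw [← lpENorm_single hp0 (0 : Fin (M + 1)) (y 1), ← lpENorm_mul_prod hp0]
      refine lpENorm_congr_norm fun q => ?_
      rw [norm_mul, norm_mul, hαk, mul_one, norm_mul]
  refine ⟨c', -(L * (K + 1)), L * (K + 1), f, fun i hi => ?_, ?_⟩
  · have h1 := Int.emod_nonneg i hL0.ne'
    have h2 := Int.emod_lt_of_pos i hL0
    have h3 := Int.mul_ediv_add_emod i L
    simp only [f]
    rw [hWK (i / L), zero_mul, zero_mul]
    intro h
    refine hi ⟨?_, ?_⟩ <;> nlinarith [h.1, h.2]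
  · calc lpENorm p (hopResid c' z f)
      _ ≤ lpENorm p W * lpENorm p ρ + (ENNReal.ofReal δ * lpENorm p W) * lpENorm p y := by
          refine hnR.trans ?_
          gcongr
          exact enorm_le_lpENorm hp0 y 1
      _ = lpENorm p W * (lpENorm p ρ + ENNReal.ofReal δ * lpENorm p y) := by ring
      _ < lpENorm p W * (ENNReal.ofReal ε * lpENorm p y) :=
          ENNReal.mul_lt_mul_right hWne hWtop hδy
      _ = _ := by rw [hnf]; ring

/-- An approximate eigenvector of a finite section gives rise to a finitely supported approximate
eigenvector of a bi-infinite matrix, of the same quality. -/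
theorem exists_finite_support_of_mem_sectionPseudospectrum {p : ℝ≥0∞} (hp : 1 ≤ p) {ε : ℝ}
    {c : ℤ → ℤˣ} {z : ℂ} {l m : ℤ} (hz : z ∈ sectionPseudospectrum p ε c l m) :
    ∃ (c' : ℤ → ℤˣ) (l' m' : ℤ) (f : ℤ → ℂ), (∀ i, i ∉ Set.Icc l' m' → f i = 0) ∧
      lpENorm p (hopResid c' z f) < ENNReal.ofReal ε * lpENorm p f := by
  have hp0 : p ≠ 0 := (zero_lt_one.trans_le hp).ne'
  have shift : ∀ (c : ℤ → ℤˣ) (f : ℤ → ℂ) (l m l' m' k : ℤ), l = l' + k → m = m' + k →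
      (∀ i, i ∉ Set.Icc l m → f i = 0) →
      lpENorm p ((Set.Icc l m).indicator (hopResid c z f)) < ENNReal.ofReal ε * lpENorm p f →
      (∀ i, i ∉ Set.Icc l' m' → f (i + k) = 0) ∧
      lpENorm p ((Set.Icc l' m').indicator
        (hopResid (fun i => c (i + k)) z (fun i => f (i + k)))) <
        ENNReal.ofReal ε * lpENorm p (fun i => f (i + k)) := by
    rintro c f _ _ l' m' k rfl rfl h0 h
    refine ⟨fun i hi => h0 _ fun h => hi ?_, ?_⟩
    · simp only [Set.mem_Icc] at h ⊢
      omega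
    · rw [lpENorm_shift hp0 f k]
      rw [← lpENorm_shift hp0 _ k] at h
      convert h using 2
      funext i
      by_cases hi : i ∈ Set.Icc l' m'
      · rw [Set.indicator_of_mem hi,
          Set.indicator_of_mem (by simp only [Set.mem_Icc] at hi ⊢; omega),
          hopResid_shift]
      · rw [Set.indicator_of_notMem hi,
          Set.indicator_of_notMem (by simp only [Set.mem_Icc] at hi ⊢; omega)]
  obtain ⟨f, hf0, hf⟩ := hz
  -- The strict inequality excludes `f = 0`, so the section is nonempty.
  have hlm : l ≤ m := by
    by_contra h
    have : f = 0 := funext fun i => hf0 i fun hi => h (hi.1.trans hi.2)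
    rw [this, lpENorm_zero, mul_zero] at hf
    exact not_lt_bot hf
  obtain ⟨N, hN⟩ : ∃ N : ℕ, m - l + 1 = N := ⟨(m - l + 1).toNat, by omega⟩
  obtain ⟨h1, h2⟩ := shift c f l m 1 N (l - 1) (by omega) (by omega) hf0 hf
  obtain ⟨c', g, hg0, hgN, hg⟩ := exists_reflected hp0 h1 h2
  obtain ⟨h3, h4⟩ := shift c' g (-N) N 1 (2 * N + 1 : ℕ) (-N - 1) (by omega) (by push_cast; omega)
    hg0 hg
  refine exists_copies hp (by omega) h3 ?_ h4
  rw [show (1 : ℤ) + (-N - 1) = -N by ring,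
    show ((2 * N + 1 : ℕ) : ℤ) + (-N - 1) = N by push_cast; ring, hgN]

/-! ### Hausdorff convergence and transplantation into pseudo-ergodic sequences -/

/-- A bounded set in the plane has finite nets made of its own points, and finitely many points lie
in `A a` simultaneously, eventually. -/
theorem tendsto_hausdorffEDist_of_subset {α : Type} {F : Filter α} {A : α → Set ℂ} {T : Set ℂ}
    (hT : Bornology.IsBounded T) (hA : ∀ a, A a ⊆ T) (h : ∀ z ∈ T, ∀ᶠ a in F, z ∈ A a) :
    Filter.Tendsto (fun a => Metric.hausdorffEDist (A a) T) F (𝓝 0) := by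
  rw [ENNReal.tendsto_nhds_zero]
  intro r hr
  obtain ⟨t, htT, htf, ht⟩ := EMetric.totallyBounded_iff'.1 
    (hT.isCompact_closure.totallyBounded.subset subset_closure) r hr
  filter_upwards [(Filter.eventually_all_finite htf).2 fun z hz => h z (htT hz)] with a ha
  refine Metric.hausdorffEDist_le_of_mem_edist (fun x hx => ⟨x, hA a hx, by simp⟩) fun x hx => ?_
  obtain ⟨y, hy, hxy⟩ := Set.mem_iUnion₂.1 (ht hx)
  exact ⟨y, ha y hy, le_of_lt hxy⟩

theorem exists_norm_hopOp_lt {p : ℝ≥0∞} [Fact (1 ≤ p)] {ε : ℝ} {S : Type} [Add S] [One S]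
    [DecidableEq S] [IsRightCancelAdd S] {b : S → ℤˣ} {g : S → ℤ} {c : ℤ → ℤˣ} {z : ℂ}
    (hε : 0 < ε) (hg : g.Injective) (hg1 : ∀ i, g (i + 1) = g i + 1)
    (hc : ∀ i, c (g i) = b i) {l m : ℤ} (hlm : Set.Icc l m ⊆ Set.range g) {f : ℤ → ℂ}
    (hf0 : ∀ i, i ∉ Set.Icc l m → f i = 0)
    (hf : lpENorm p (hopResid c z f) < ENNReal.ofReal ε * lpENorm p f) :
    ∃ x, ‖hopOp p b x - z • x‖ < ε * ‖x‖ := by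
  have hp0 : p ≠ 0 := (zero_lt_one.trans_le (Fact.out : 1 ≤ p)).ne'
  have hfr : ∀ i, i ∉ Set.range g → f i = 0 := fun i hi => hf0 i fun h => hi (hlm h)
  have hmem : Memℓp (fun i => f (g i)) p := by
    refine memℓp_of_lpENorm_ne_top hp0 ?_
    rw [lpENorm_comp hp0 hg hfr]
    exact lpENorm_ne_top_of_support_subset hp0 (Set.finite_Icc l m) hf0
  refine ⟨⟨_, hmem⟩, ?_⟩
  rw [norm_lt_iff_enorm_lt hε, enorm_lp_eq, enorm_lp_eq]
  have h1 := lpENorm_comp hp0 hg hfr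
  refine lt_of_le_of_lt ?_ (hf.trans_eq (by rw [← h1]))
  have h2 : ⇑(hopOp p b ⟨_, hmem⟩ - z • (⟨_, hmem⟩ : lp (fun _ : S => ℂ) p)) =
      fun i => (Set.range g).indicator (hopResid c z f) (g i) := funext fun i => by
    rw [hopOp_sub_apply hg hg1 hc _ hfr (fun _ => rfl),
      Set.indicator_of_mem (Set.mem_range_self i)]
  rw [h2, lpENorm_comp hp0 hg fun i hi => Set.indicator_of_notMem hi _]
  exact lpENorm_mono fun i => norm_indicator_le_norm_self _ _

theorem exists_transplant {p : ℝ≥0∞} [Fact (1 ≤ p)] {ε : ℝ} {S : Type} {g : S → ℤ} {c : ℤ → ℤˣ}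
    {z : ℂ} (herg : ∀ (c₀ : ℤ → ℤˣ) (l m : ℤ), ∃ J : ℤ, ∀ i ∈ Set.Icc l m,
      i + J ∈ Set.range g ∧ c (i + J) = c₀ i) {c₀ : ℤ → ℤˣ} {l₀ m₀ : ℤ}
    (hz : z ∈ sectionPseudospectrum p ε c₀ l₀ m₀) :
    ∃ (l m : ℤ) (f : ℤ → ℂ), l ∈ Set.range g ∧ Set.Icc l m ⊆ Set.range g ∧
      (∀ i, i ∉ Set.Icc l m → f i = 0) ∧
      lpENorm p (hopResid c z f) < ENNReal.ofReal ε * lpENorm p f := by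
  have hp : 1 ≤ p := Fact.out
  have hp0 : p ≠ 0 := (zero_lt_one.trans_le hp).ne'
  obtain ⟨c', l, m, f, hf0, hf⟩ := exists_finite_support_of_mem_sectionPseudospectrum hp hz
  have hlm : l ≤ m := by
    by_contra h
    have : f = 0 := funext fun i => hf0 i fun hi => h (hi.1.trans hi.2)
    rw [this, lpENorm_zero, mul_zero] at hf
    exact not_lt_bot hf
  obtain ⟨J, hJ⟩ := herg c' l m
  refine ⟨l + J, m + J, fun i => f (i + -J), (hJ l ⟨le_rfl, hlm⟩).1, fun i hi => ?_,
    fun i hi => hf0 _ fun h => hi ?_, ?_⟩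
  · have := (hJ (i - J) (by simp only [Set.mem_Icc] at hi ⊢; omega)).1
    rwa [sub_add_cancel] at this
  · simp only [Set.mem_Icc] at h ⊢
    omega
  · have h1 : hopResid c z (fun i => f (i + -J)) = fun i => hopResid c' z f (i + -J) := by
      funext i
      rw [← hopResid_shift c' z f (-J) i]
      simp only [hopResid]
      -- The signs need to agree only where they multiply a nonzero entry of `f`.
      by_cases h : i - 1 + -J ∈ Set.Icc l m
      · have := (hJ _ h).2
        rw [neg_add_cancel_right] at this
        rw [this]
      · rw [hf0 _ h, mul_zero, mul_zero]
    rw [h1, lpENorm_shift hp0, lpENorm_shift hp0]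
    exact hf

theorem exists_mem_sectionPseudospectrum_int {p : ℝ≥0∞} [Fact (1 ≤ p)] {ε : ℝ} (hε : 0 < ε) (c : ℤ → ℤˣ)
    {z : ℂ} (hz : z ∈ pseudospectrum ε (hopOp p c)) : ∃ l m, z ∈ sectionPseudospectrum p ε c l m :=
  exists_mem_sectionPseudospectrum_of_mem_pseudospectrum_hopOp hε (g := id) Function.injective_id
    (fun _ => rfl) (fun _ => rfl)
    (fun i _ n => ⟨i - n, i + n, by simp, by simp, fun _ => rfl, fun _ => rfl⟩)
    (l := fun n => -n) (m := fun n => n) (fun _ => by simp)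
    (fun i _ => by
      filter_upwards [Filter.eventually_ge_atTop i.natAbs] with n hn
      simp only [Set.mem_Icc]
      omega) hz

theorem exists_mem_sectionPseudospectrum_pnat {p : ℝ≥0∞} [Fact (1 ≤ p)] {ε : ℝ} (hε : 0 < ε) {b : ℕ+ → ℤˣ}
    {c : ℤ → ℤˣ} (hc : ∀ i : ℕ+, c (i : ℕ) = b i) {z : ℂ}
    (hz : z ∈ pseudospectrum ε (hopOp p b)) : ∃ l m, z ∈ sectionPseudospectrum p ε c l m := by
  have hr : Set.range (fun i : ℕ+ => ((i : ℕ) : ℤ)) = Set.Ici 1 := by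
    ext i
    refine ⟨?_, fun hi => ?_⟩
    · rintro ⟨k, rfl⟩
      have := k.pos
      simp only [Set.mem_Ici]
      omega
    · simp only [Set.mem_Ici] at hi
      exact ⟨⟨i.toNat, by omega⟩, by simp; omega⟩
  refine exists_mem_sectionPseudospectrum_of_mem_pseudospectrum_hopOp hε
    (g := fun i : ℕ+ => ((i : ℕ) : ℤ)) (fun a b h => PNat.eq (by simpa using h))
    (fun _ => by simp) hc ?_ (l := fun _ => 1) (m := fun n => n) ?_ ?_ hz
  · rw [hr]
    intro i hi n
    simp only [Set.mem_Ici] at hi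
    -- The left end is the true boundary: `0` is outside the range, so nothing is required of `l`
    -- there.
    refine ⟨1, i + n, Set.Icc_subset_Ici_self, ?_, fun h => ?_, fun _ => rfl⟩
    · simp only [Set.mem_Icc]
      omega
    · simp at h
  · rw [hr]
    exact fun _ => Set.Icc_subset_Ici_self
  · rw [hr]
    intro i hi
    filter_upwards [Filter.eventually_ge_atTop i.natAbs] with n hn
    simp only [Set.mem_Icc, Set.mem_Ici] at hi ⊢
    omega

/-- The common part of the semi-infinite and of the bi-infinite case. -/
theorem pseudospectrum_hopOp_of_ergodic {p : ℝ≥0∞} [Fact (1 ≤ p)] {ε : ℝ} (hε : 0 < ε) {S : Type}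
    [Add S] [One S] [DecidableEq S] [IsRightCancelAdd S] {b : S → ℤˣ} {g : S → ℤ} {c : ℤ → ℤˣ}
    (hg : g.Injective) (hg1 : ∀ i, g (i + 1) = g i + 1) (hc : ∀ i, c (g i) = b i)
    (herg : ∀ (c₀ : ℤ → ℤˣ) (l m : ℤ), ∃ J : ℤ, ∀ i ∈ Set.Icc l m,
      i + J ∈ Set.range g ∧ c (i + J) = c₀ i)
    (hsec : ∀ z ∈ pseudospectrum ε (hopOp p b), ∃ l m, z ∈ sectionPseudospectrum p ε c l m) :
    (∀ l m, sectionPseudospectrum p ε c l m ⊆ pseudospectrum ε (hopOp p b)) ∧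
    pseudospectrum ε (hopOp p b) = SigmaEps p ε ∧
    Bornology.IsBounded (pseudospectrum ε (hopOp p b)) ∧
    ∀ z ∈ pseudospectrum ε (hopOp p b), ∃ l ∈ Set.range g, ∃ m, ∀ l' m', l' ≤ l → m ≤ m' →
      z ∈ sectionPseudospectrum p ε c l' m' := by
  have key : ∀ c₀ l m, ∀ z ∈ sectionPseudospectrum p ε c₀ l m,
      ∃ x, ‖hopOp p b x - z • x‖ < ε * ‖x‖ := by
    intro c₀ l₀ m₀ z hz
    obtain ⟨l, m, f, -, hlm, hf0, hf⟩ := exists_transplant herg hz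
    exact exists_norm_hopOp_lt hε hg hg1 hc hlm hf0 hf
  have key' : ∀ c₀ l m, sectionPseudospectrum p ε c₀ l m ⊆ pseudospectrum ε (hopOp p b) := by
    intro c₀ l₀ m₀ z hz
    obtain ⟨x, hx⟩ := key c₀ l₀ m₀ z hz
    exact mem_pseudospectrum_of_lt hε hx
  refine ⟨key' c, ?_, ?_, ?_⟩
  · refine Set.Subset.antisymm (fun z hz => ?_) (Set.iUnion_subset fun c₀ z hz => ?_)
    · obtain ⟨l, m, h⟩ := hsec z hz
      obtain ⟨c', l', m', f, hf0, hf⟩ :=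
        exists_finite_support_of_mem_sectionPseudospectrum Fact.out h
      obtain ⟨x, hx⟩ := exists_norm_hopOp_lt hε (g := id) Function.injective_id (fun _ => rfl)
        (fun _ => rfl) (by simp) hf0 hf
      exact Set.mem_iUnion.2 ⟨c', mem_pseudospectrum_of_lt hε hx⟩
    · obtain ⟨l, m, h⟩ := exists_mem_sectionPseudospectrum_int hε c₀ hz
      exact key' c₀ l m h
  -- An approximate eigenvector `x` gives `‖z‖ ‖x‖ ≤ ‖A x‖ + ε ‖x‖`.
  · refine isBounded_iff_forall_norm_le.2 ⟨‖hopOp p b‖ + ε, fun z hz => ?_⟩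
    obtain ⟨l, m, h⟩ := hsec z hz
    obtain ⟨x, hx⟩ := key c l m z h
    have h1 : ‖z‖ * ‖x‖ ≤ ‖hopOp p b x‖ + ‖hopOp p b x - z • x‖ := by
      rw [← norm_smul]
      calc ‖z • x‖ = ‖hopOp p b x - (hopOp p b x - z • x)‖ := by rw [sub_sub_cancel]
        _ ≤ _ := norm_sub_le _ _
    have h2 := (hopOp p b).le_opNorm x
    have hx0 : 0 < ‖x‖ := by
      by_contra h
      have : ‖x‖ = 0 := le_antisymm (not_lt.1 h) (norm_nonneg x)
      rw [this, mul_zero] at hx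
      exact absurd hx (not_lt.2 (norm_nonneg _))
    refine le_of_mul_le_mul_right ?_ hx0
    linarith
  · intro z hz
    obtain ⟨l₀, m₀, h⟩ := hsec z hz
    obtain ⟨l, m, f, hl, -, hf0, hf⟩ := exists_transplant herg h
    -- The untruncated residual is already small, so the same `f` serves every larger section.
    refine ⟨l, hl, m, fun l' m' hl' hm' => ⟨f, fun i hi => hf0 i fun h => hi ?_, ?_⟩⟩
    · exact ⟨hl'.trans h.1, h.2.trans hm'⟩
    · exact (lpENorm_mono fun i => norm_indicator_le_norm_self _ _).trans_lt hf

/-! ### The concrete matrices and the two kinds of pseudo-ergodicity -/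

theorem pseudospectrum_sectionMatrix_int {p : ℝ≥0∞} [Fact (1 ≤ p)] {ε : ℝ} (hε : 0 < ε)
    (b : ℤ → ℤˣ) (l m : ℤ) :
    pseudospectrum ε (matOp p (sectionMatrix b l m)) = sectionPseudospectrum p ε b l m := by
  refine pseudospectrum_matOp hε (g := fun i : Finset.Icc l m => (i : ℤ)) Subtype.val_injective
    (by ext i; simp) fun i j => ?_
  simp only [sectionMatrix, hopMatrix, Matrix.submatrix_apply, Matrix.of_apply]
  congr 1
  · exact if_congr (by omega) rfl rfl
  · exact if_congr eq_comm rfl rfl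

theorem pseudospectrum_sectionMatrix_pnat {p : ℝ≥0∞} [Fact (1 ≤ p)] {ε : ℝ} (hε : 0 < ε)
    {b : ℕ+ → ℤˣ} {c : ℤ → ℤˣ} (hc : ∀ i : ℕ+, c (i : ℕ) = b i) (n : ℕ+) :
    pseudospectrum ε (matOp p (sectionMatrix b 1 n)) =
      sectionPseudospectrum p ε c 1 (n : ℕ) := by
  refine pseudospectrum_matOp hε (g := fun i : Finset.Icc 1 n => (((i : ℕ+) : ℕ) : ℤ))
    (fun a b h => Subtype.ext (PNat.eq (by simpa using h))) ?_ fun i j => ?_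
  · ext i
    simp only [Set.mem_range, Set.mem_Icc]
    constructor
    · rintro ⟨⟨k, hk⟩, rfl⟩
      have h1 := (Finset.mem_Icc.1 hk).2
      have h2 : (k : ℕ) ≤ n := h1
      have := k.pos
      dsimp only
      omega
    · rintro ⟨h1, h2⟩
      obtain ⟨k, rfl⟩ : ∃ k : ℕ+, ((k : ℕ) : ℤ) = i := ⟨⟨i.toNat, by omega⟩, by simp; omega⟩
      exact ⟨⟨k, Finset.mem_Icc.2 ⟨one_le, by exact_mod_cast h2⟩⟩, rfl⟩
  · simp only [sectionMatrix, hopMatrix, Matrix.submatrix_apply, Matrix.of_apply, hc]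
    congr 1
    · refine if_congr ?_ rfl rfl
      rw [← PNat.coe_inj, PNat.add_coe, PNat.one_coe]
      omega
    · refine if_congr ?_ rfl rfl
      rw [← PNat.coe_inj, PNat.add_coe, PNat.one_coe]
      omega

theorem pseudospectrum_finMatrix {p : ℝ≥0∞} [Fact (1 ≤ p)] {ε : ℝ} (hε : 0 < ε)
    {b : ℕ+ → ℤˣ} {c : ℤ → ℤˣ} (hc : ∀ i : ℕ+, c (i : ℕ) = b i) (n : ℕ) :
    pseudospectrum ε (matOp p (finMatrix b n)) = sectionPseudospectrum p ε c 1 n := by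
  refine pseudospectrum_matOp hε (g := fun i : Fin n => ((i : ℕ) : ℤ) + 1)
    (fun a b h => Fin.ext (by simpa using h)) ?_ fun i j => ?_
  · ext i
    simp only [Set.mem_range, Set.mem_Icc]
    constructor
    · rintro ⟨k, rfl⟩
      have := k.2
      omega
    · rintro ⟨h1, h2⟩
      exact ⟨⟨(i - 1).toNat, by omega⟩, by dsimp only; omega⟩
  · have e : c (((j : ℕ) : ℤ) + 1) = b (Nat.succPNat j) := by
      rw [← hc]
      simp
    simp only [finMatrix, Matrix.of_apply, e]
    by_cases h1 : (i : ℕ) = j + 1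
    · rw [if_pos h1, if_pos (by omega), if_neg (by omega), add_zero]
    · rw [if_neg h1, if_neg (show ¬((i : ℕ) : ℤ) + 1 - 1 = j + 1 by omega), zero_add]
      exact if_congr (by omega) rfl rfl

theorem PseudoErgodicInt.exists_shift {b : ℤ → ℤˣ} (hb : PseudoErgodicInt b) (c₀ : ℤ → ℤˣ)
    (l m : ℤ) : ∃ J : ℤ, ∀ i ∈ Set.Icc l m, b (i + J) = c₀ i := by
  obtain ⟨J, hJ⟩ := hb (m - l + 1).toNat fun n => c₀ (l + (n : ℕ))
  refine ⟨J + 1 - l, fun i hi => ?_⟩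
  simp only [Set.mem_Icc] at hi
  have h := hJ ⟨(i - l).toNat, by omega⟩
  dsimp only at h
  rw [show l + ((i - l).toNat : ℤ) = i by omega] at h
  rw [← h]
  congr 1
  omega

theorem PseudoErgodicNat.exists_shift {b : ℕ+ → ℤˣ} (hb : PseudoErgodicNat b) {c : ℤ → ℤˣ}
    (hc : ∀ i : ℕ+, c (i : ℕ) = b i) (c₀ : ℤ → ℤˣ) (l m : ℤ) :
    ∃ J : ℤ, ∀ i ∈ Set.Icc l m,
      i + J ∈ Set.range (fun i : ℕ+ => ((i : ℕ) : ℤ)) ∧ c (i + J) = c₀ i := by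
  obtain ⟨J, hJ⟩ := hb (m - l + 1).toNat fun n => c₀ (l + (n : ℕ))
  refine ⟨J + 1 - l, fun i hi => ?_⟩
  simp only [Set.mem_Icc] at hi
  have h := hJ ⟨(i - l).toNat, by omega⟩
  dsimp only at h
  rw [show l + ((i - l).toNat : ℤ) = i by omega] at h
  have e : ((Nat.succPNat ((i - l).toNat + J) : ℕ) : ℤ) = i + (J + 1 - l) := by
    rw [Nat.succPNat_coe]
    omega
  exact ⟨⟨_, e⟩, by rw [← h, ← hc, e]⟩

end HoppingSign

end

theorem corollary4p5 (p : ℝ≥0∞) [Fact (1 ≤ p)] (ε : ℝ) (hε : 0 < ε) :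
    (∀ b : ℕ+ → ℤˣ, HoppingSign.PseudoErgodicNat b →
      (∀ n : ℕ+, HoppingSign.pseudospectrum ε (HoppingSign.matOp p (HoppingSign.finMatrix b n)) =
        HoppingSign.pseudospectrum ε (HoppingSign.matOp p (HoppingSign.sectionMatrix b 1 n))) ∧
      (∀ n : ℕ+, HoppingSign.pseudospectrum ε (HoppingSign.matOp p (HoppingSign.finMatrix b n)) ⊆
        HoppingSign.pseudospectrum ε (HoppingSign.hopOp p b)) ∧
      Filter.Tendsto (fun n : ℕ+ => Metric.hausdorffEDist
          (HoppingSign.pseudospectrum ε (HoppingSign.matOp p (HoppingSign.finMatrix b n)))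
          (HoppingSign.pseudospectrum ε (HoppingSign.hopOp p b)))
        Filter.atTop (𝓝 0) ∧
      HoppingSign.pseudospectrum ε (HoppingSign.hopOp p b) = HoppingSign.SigmaEps p ε) ∧
    (∀ b : ℤ → ℤˣ, HoppingSign.PseudoErgodicInt b →
      (∀ l m : ℤ, l ≤ m →
        HoppingSign.pseudospectrum ε (HoppingSign.matOp p (HoppingSign.sectionMatrix b l m)) ⊆
          HoppingSign.pseudospectrum ε (HoppingSign.hopOp p b)) ∧
      Filter.Tendsto (fun q : ℤ × ℤ => Metric.hausdorffEDist
          (HoppingSign.pseudospectrum ε (HoppingSign.matOp p (HoppingSign.sectionMatrix b q.1 q.2)))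
          (HoppingSign.pseudospectrum ε (HoppingSign.hopOp p b)))
        (Filter.atBot ×ˢ Filter.atTop) (𝓝 0) ∧
      HoppingSign.pseudospectrum ε (HoppingSign.hopOp p b) = HoppingSign.SigmaEps p ε) := by
  refine ⟨fun b hb => ?_, fun b hb => ?_⟩
  · have hinj : Function.Injective fun i : ℕ+ => ((i : ℕ) : ℤ) :=
      fun a b h => PNat.eq (by simpa using h)
    obtain ⟨c, hc⟩ : ∃ c : ℤ → ℤˣ, ∀ i : ℕ+, c (i : ℕ) = b i :=
      ⟨Function.extend (fun i : ℕ+ => ((i : ℕ) : ℤ)) b 1, fun i => hinj.extend_apply _ _ i⟩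
    have hfin : ∀ n : ℕ+, _ := fun n => HoppingSign.pseudospectrum_finMatrix (p := p) hε hc n
    obtain ⟨h1, h2, h3, h4⟩ := HoppingSign.pseudospectrum_hopOp_of_ergodic (p := p) hε hinj
      (fun i => by simp) hc (hb.exists_shift hc)
      (fun z hz => HoppingSign.exists_mem_sectionPseudospectrum_pnat hε hc hz)
    refine ⟨fun n => ?_, fun n => ?_, ?_, h2⟩
    · rw [hfin, HoppingSign.pseudospectrum_sectionMatrix_pnat hε hc]
    · rw [hfin]
      exact h1 _ _
    · simp only [hfin]
      refine HoppingSign.tendsto_hausdorffEDist_of_subset h3 (fun n => h1 _ _) fun z hz => ?_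
      -- The left end of the support is a positive integer `k`, so sections starting at `1` contain
      -- the support once `n ≥ m`.
      obtain ⟨_, ⟨k, rfl⟩, m, hm⟩ := h4 z hz
      filter_upwards [Filter.eventually_ge_atTop (Nat.succPNat m.toNat)] with n hn
      have hn' : m.toNat + 1 ≤ (n : ℕ) := by
        simpa using PNat.coe_le_coe _ _ |>.2 hn
      have := k.pos
      exact hm _ _ (by dsimp only; omega) (by omega)
  · obtain ⟨h1, h2, h3, h4⟩ := HoppingSign.pseudospectrum_hopOp_of_ergodic (p := p) hε (b := b)
      (g := id) (c := b) Function.injective_id (fun _ => rfl) (fun _ => rfl)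
      (fun c₀ l m => (hb.exists_shift c₀ l m).imp fun J hJ i hi => ⟨⟨_, rfl⟩, hJ i hi⟩)
      (fun z hz => HoppingSign.exists_mem_sectionPseudospectrum_int hε b hz)
    simp only [HoppingSign.pseudospectrum_sectionMatrix_int hε]
    refine ⟨fun l m _ => h1 l m, ?_, h2⟩
    refine HoppingSign.tendsto_hausdorffEDist_of_subset h3 (fun q => h1 _ _) fun z hz => ?_
    obtain ⟨l, -, m, hm⟩ := h4 z hz
    filter_upwards [(Filter.eventually_le_atBot l).prod_mk (Filter.eventually_ge_atTop m)] with q hq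
    exact hm _ _ hq.1 hq.2
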